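/- Let $n\ge 1$ and let $f\in\mathbb C[x_1^{\pm1},\dots,x_n^{\pm1}]$ be a Laurent polynomial whose Newton polytope (the convex hull in $\mathbb R^n$ of the exponents of $f$) contains $0$ in its interior. Let $\phi_f(i)$ be the constant term of $f^i$ and $\Phi_f(t)=\sum_{i\ge0}\phi_f(i)t^i\in\mathbb C[[t]]$. For $t\neq0$ put $F_t=1-tf$ and $Y_t=\{F_t=0\}\subset(\mathbb C^*)^n$. Then there is an algebraic fiberwise $(n-1)$-form $\omega_t$ on the pencil $\{Y_t\}$ (its coefficients are Laurent polynomials in $x$ over $\mathbb C(t)$) such that: (1) for some $\varepsilon>0$ and all $0<|t|<\varepsilon$, the form $\omega_t$ is the Poincaré residue along $Y_t$ of $$\frac{1}{(2\pi i)^{n-1}}\,\frac{1}{1-tf}\,\frac{dx_1}{x_1}\wedge\dots\wedge\frac{dx_n}{x_n},$$ that is, $dF_t\wedge\omega_t=(2\pi i)^{-(n-1)}\frac{dx_1}{x_1}\wedge\dots\wedge\frac{dx_n}{x_n}$ at every point of $Y_t$ (in particular $Y_t$ is smooth); and every $t_0$ with $0<|t_0|<\varepsilon$ has an open neighbourhood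 $D$ with a family of singular $(n-1)$-cycles $\Delta_t\subset Y_t$, $t\in D$, depending smoothly on $t$, such that for all $t\in D$ the series $\Phi_f(t)$ converges and $$\Phi_f(t)=\int_{\Delta_t}\omega_t .$$ (2) $\Phi_f$ is a solution of the Picard--Fuchs equation of the pencil: if $L=\sum_k a_k(t)\,(d/dt)^k\ne0$, $a_k\in\mathbb C[t]$, annihilates all periods $\int_{\gamma_t}\omega_t$, where $\gamma_t\subset Y_t$ is any smooth family of singular $(n-1)$-cycles over an open set of parameters $t\ne0$ for which $\omega_t$ is the residue form in (1), then $L\Phi_f=0$ in $\mathbb C[[t]]$. -/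

import Mathlib

noncomputable section

namespace LaurentPencil

/-- Laurent polynomials `R[ℤⁿ]` in `n` variables. -/
abbrev LaurentPoly (R : Type) [Semiring R] (n : ℕ) : Type := AddMonoidAlgebra R (Fin n → ℤ)

/-- The monomial `x₁^{a₁} ⋯ xₙ^{aₙ}`. -/
def monom {n : ℕ} (a : Fin n → ℤ) (x : Fin n → ℂ) : ℂ := ∏ i, x i ^ a i

/-- The value of a Laurent polynomial at a point (used only where all coordinates are nonzero). -/
def eval {n : ℕ} (f : LaurentPoly ℂ n) (x : Fin n → ℂ) : ℂ :=
  f.coeff.sum fun a c => c * monom a x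

/-- The Newton polytope, in `ℝⁿ`. -/
def newtonPolytope {n : ℕ} (f : LaurentPoly ℂ n) : Set (Fin n → ℝ) :=
  convexHull ℝ ((fun (a : Fin n → ℤ) (i : Fin n) => (a i : ℝ)) '' (f.coeff.support : Set (Fin n → ℤ)))

/-- The constant term `φ_f(i)` of `f ^ i`. -/
def constTerm {n : ℕ} (f : LaurentPoly ℂ n) (i : ℕ) : ℂ := (f ^ i).coeff 0

/-- The constant terms series `Φ_f`. -/
def constTermSeries {n : ℕ} (f : LaurentPoly ℂ n) : PowerSeries ℂ := PowerSeries.mk (constTerm f)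

/-- The function `F_t = 1 - t f`. -/
def pencilFun {n : ℕ} (f : LaurentPoly ℂ n) (t : ℂ) (x : Fin n → ℂ) : ℂ := 1 - t * eval f x

/-- The fibre `Y_t = (F_t = 0)` of the pencil, a hypersurface in the torus `(ℂ^*)ⁿ`. -/
def fiber {n : ℕ} (f : LaurentPoly ℂ n) (t : ℂ) : Set (Fin n → ℂ) :=
  {x | (∀ i, x i ≠ 0) ∧ pencilFun f t x = 0}

/-! ### Differential forms and Poincaré residues -/

/-- Holomorphic-type `k`-forms on `ℂⁿ`: at every point a `ℂ`-multilinear alternating map. -/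
abbrev Form (n k : ℕ) : Type := (Fin n → ℂ) → (Fin n → ℂ) [⋀^Fin k]→ₗ[ℂ] ℂ

/-- The form `dx₁/x₁ ∧ … ∧ dxₙ/xₙ`. -/
def dlogVol (n : ℕ) : Form n n := fun x =>
  (Matrix.detRowAlternating (R := ℂ) (n := Fin n)).compLinearMap
    (LinearMap.pi fun k => (x k)⁻¹ • LinearMap.proj k)

/-- The form `dx₁/x₁ ∧ … ∧ dxₙ/xₙ` with the factor number `i` left out, `n = m + 1`. -/
def dlogOmit (m : ℕ) (i : Fin (m + 1)) : Form (m + 1) m := fun x =>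
  (Matrix.detRowAlternating (R := ℂ) (n := Fin m)).compLinearMap
    (LinearMap.pi fun k => (x (i.succAbove k))⁻¹ • LinearMap.proj (i.succAbove k))

/-- The wedge product `α ∧ η` of a covector and an alternating `k`-form:
`(α ∧ η)(v₀, …, v_k) = ∑ᵢ (-1)ⁱ α(vᵢ) η(v₀, …, v̂ᵢ, …, v_k)`. -/
def wedgeCovector {n k : ℕ} (α : (Fin n → ℂ) →ₗ[ℂ] ℂ) (η : (Fin n → ℂ) [⋀^Fin k]→ₗ[ℂ] ℂ) :
    (Fin n → ℂ) [⋀^Fin (k + 1)]→ₗ[ℂ] ℂ :=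
  AlternatingMap.alternatizeUncurryFin (LinearMap.smulRight α η)

/-- `η` restricts to the Poincaré residue along the smooth hypersurface `Y = (F = 0)` of the
top-degree form `Θ / F` with a simple pole: `dF ∧ η = Θ` at the points of `Y`. Where `Θ ≠ 0` this
forces `dF ≠ 0`, and it determines `η` on the tangent spaces `ker dF` of `Y`. -/
def IsPoincareResidue {m : ℕ} (Y : Set (Fin (m + 1) → ℂ)) (F : (Fin (m + 1) → ℂ) → ℂ)
    (Θ : Form (m + 1) (m + 1)) (η : Form (m + 1) m) : Prop :=
  ∀ x ∈ Y, wedgeCovector (fderiv ℂ F x : (Fin (m + 1) → ℂ) →ₗ[ℂ] ℂ) (η x) = Θ x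

/-- A fiberwise algebraic form of degree `m = n - 1` on the pencil, regular over a Zariski open
part of the base: `∑ᵢ cᵢ(t, x) / d(t) · ⋀_{k ≠ i} dx_k/x_k`, where the `cᵢ` are Laurent polynomials
in `x` whose coefficients are polynomials in `t`, and `d ≠ 0`. -/
structure RelativeForm (m : ℕ) where
  /-- the common denominator `d` -/
  den : Polynomial ℂ
  den_ne_zero : den ≠ 0
  /-- the numerators `cᵢ` -/
  num : Fin (m + 1) → LaurentPoly (Polynomial ℂ) (m + 1)

/-- The value of the form at the parameter `t`. -/
def RelativeForm.at {m : ℕ} (ω : RelativeForm m) (t : ℂ) : Form (m + 1) m := fun x =>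
  ∑ i, (((ω.num i).coeff.sum fun a p => p.eval t * monom a x) / ω.den.eval t) • dlogOmit m i x

/-- On `Y_t`, the form `ω_t` is the Poincaré residue of
`(2πi)^{-(n-1)} · 1 / (1 - t f) · dx₁/x₁ ∧ … ∧ dxₙ/xₙ`, where `n = m + 1`. -/
def IsResidueAt {m : ℕ} (f : LaurentPoly ℂ (m + 1)) (ω : RelativeForm m) (t : ℂ) : Prop :=
  IsPoincareResidue (fiber f t) (pencilFun f t)
    (fun x => ((2 * (Real.pi : ℂ) * Complex.I) ^ m)⁻¹ • dlogVol (m + 1) x) (ω.at t)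

/-! ### Cubical singular chains, cycles, integration -/

/-- Singular `k`-cubes. -/
abbrev SCube (X : Type) (k : ℕ) : Type := (Fin k → unitInterval) → X

/-- Singular cubical `k`-chains with integer coefficients. -/
abbrev SChain (X : Type) (k : ℕ) : Type := SCube X k →₀ ℤ

/-- The face of a cube on which the coordinate number `i` equals `e`. -/
def SCube.face {X : Type} {k : ℕ} (σ : SCube X (k + 1)) (i : Fin (k + 1)) (e : unitInterval) : SCube X k :=
  fun θ => σ (i.insertNth (α := fun _ => unitInterval) e θ)

/-- A cube is degenerate if it does not depend on one of its coordinates. -/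
def SCube.IsDegenerate {X : Type} {k : ℕ} (σ : SCube X k) : Prop :=
  ∃ i : Fin k, ∀ (θ : Fin k → unitInterval) (s : unitInterval), σ (Function.update θ i s) = σ θ

/-- The chains that are combinations of degenerate cubes. -/
def degenerateChains (X : Type) (k : ℕ) : AddSubgroup (SChain X k) :=
  AddSubgroup.closure {c | ∃ σ : SCube X k, σ.IsDegenerate ∧ c = Finsupp.single σ 1}

/-- The cubical boundary. -/
def SChain.boundary {X : Type} {k : ℕ} (c : SChain X (k + 1)) : SChain X k :=
  c.sum fun σ a => a • ∑ i : Fin (k + 1),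
    (-1 : ℤ) ^ (i : ℕ) • (Finsupp.single (σ.face i 1) (1 : ℤ) - Finsupp.single (σ.face i 0) 1)

/-- Cycles of the normalized cubical complex (cubical chains modulo degenerate ones). -/
def SChain.IsCycle {X : Type} : {k : ℕ} → SChain X k → Prop
  | 0, _ => True
  | _ + 1, c => c.boundary ∈ degenerateChains X _

/-- The projection of `ℝᵏ` onto the unit cube, which is the identity on the cube. -/
def clampCube {k : ℕ} (θ : Fin k → ℝ) : Fin k → unitInterval :=
  fun i => Set.projIcc (0 : ℝ) 1 zero_le_one (θ i)

/-- The integral of a `k`-form over a (smooth) singular `k`-cube `σ`: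
`∫_{[0,1]^k} η_{σ(θ)}(∂₁σ, …, ∂_kσ) dθ`. -/
def integralCube {n k : ℕ} (η : Form n k) (σ : SCube (Fin n → ℂ) k) : ℂ :=
  ∫ θ in Set.Icc (0 : Fin k → ℝ) 1,
    η (σ (clampCube θ)) fun j =>
      fderivWithin ℝ (fun θ' => σ (clampCube θ')) (Set.Icc 0 1) θ (Pi.single j 1)

/-- The integral of a `k`-form over a singular chain. -/
def integralChain {n k : ℕ} (η : Form n k) (c : SChain (Fin n → ℂ) k) : ℂ :=
  c.sum fun σ a => (a : ℂ) * integralCube η σ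

/-- A fiberwise `(n-1)`-cycle of the pencil over a set `D` of parameters (`n = m + 1`): a fixed
integer combination of singular `m`-cubes `σⱼ(t) : [0,1]^m → Y_t` that depend smoothly on `t ∈ D`
and on the point of the cube, such that the combination is a cycle for every `t ∈ D`. The homology
classes of the cycles are thus locally constant in `t`. -/
structure CycleFamily {m : ℕ} (f : LaurentPoly ℂ (m + 1)) (D : Set ℂ) where
  /-- the number of cubes -/
  size : ℕ
  /-- the coefficients -/
  coef : Fin size → ℤ
  /-- the cubes -/
  cube : Fin size → ℂ → SCube (Fin (m + 1) → ℂ) m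
  smooth : ∀ j, ContDiffOn ℝ (⊤ : ℕ∞) (fun p : ℂ × (Fin m → ℝ) => cube j p.1 (clampCube p.2))
    (D ×ˢ Set.Icc 0 1)
  mem_fiber : ∀ j, ∀ t ∈ D, ∀ θ, cube j t θ ∈ fiber f t
  isCycle : ∀ t ∈ D, SChain.IsCycle (∑ j, Finsupp.single (cube j t) (coef j))

/-- The cycle `Δ_t` of the family. -/
def CycleFamily.chain {m : ℕ} {f : LaurentPoly ℂ (m + 1)} {D : Set ℂ} (Δ : CycleFamily f D)
    (t : ℂ) : SChain (Fin (m + 1) → ℂ) m :=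
  ∑ j, Finsupp.single (Δ.cube j t) (Δ.coef j)

/-- The period `∫_{Δ_t} ω_t`. -/
def period {m : ℕ} {f : LaurentPoly ℂ (m + 1)} {D : Set ℂ} (ω : RelativeForm m)
    (Δ : CycleFamily f D) (t : ℂ) : ℂ :=
  integralChain (ω.at t) (Δ.chain t)

/-! ### Differential operators and the Picard–Fuchs equation -/

/-- Differential operators `∑ₖ aₖ(t) (d/dt)ᵏ` with polynomial coefficients; `aₖ` is the
coefficient number `k` of the outer polynomial. -/
abbrev DiffOp : Type := Polynomial (Polynomial ℂ)

/-- The value at `t` of the operator applied to a function. -/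
def DiffOp.applyFun (L : DiffOp) (p : ℂ → ℂ) (t : ℂ) : ℂ :=
  L.sum fun k a => a.eval t * iteratedDeriv k p t

/-- The operator applied to a formal power series. -/
def DiffOp.applySeries (L : DiffOp) (Φ : PowerSeries ℂ) : PowerSeries ℂ :=
  L.sum fun k a => (a : PowerSeries ℂ) * (PowerSeries.derivative ℂ)^[k] Φ

/-- `L = 0` is a Picard–Fuchs equation of the pencil `{Y_t}` with the fiberwise form `ω_t`: `L` is
a nonzero operator that annihilates all periods `∫_{γ_t} ω_t`, for all fiberwise cycles `γ_t`
defined over open sets of parameters `t ≠ 0` for which `ω_t` is the residue form on `Y_t`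
(so that `Y_t` is smooth). The operators of minimal order with this property are included. -/
def IsPicardFuchs {m : ℕ} (f : LaurentPoly ℂ (m + 1)) (ω : RelativeForm m) (L : DiffOp) : Prop :=
  L ≠ 0 ∧ ∀ D : Set ℂ, IsOpen D → (∀ t ∈ D, t ≠ 0 ∧ IsResidueAt f ω t) →
    ∀ γ : CycleFamily f D, ∀ t ∈ D, L.applyFun (period ω γ) t = 0

end LaurentPencil

end

/-!
Write `x₀` for the first variable. Some monomial of `f` has a negative exponent of `x₀`, so among
the terms of lowest degree `-N` in `x₀` one can choose a vertex `v` of their convex hull and radii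
`r` such that on the torus `|xⱼ| = rⱼ`, `j ≥ 1`, and for `|x₀| ≤ r₀` the term `c_v x^v` dominates
`f`. With `x₀ = r₀ s` and the angles `θ` of the other coordinates fixed, the equation `t f = 1`
becomes `s = w φ_θ(s)`, where `w` runs through the `N`-th roots of `t c_v r^v exp (2πi ⟨v, θ⟩)` and
`φ_θ` is holomorphic near `0`. Its `N` solutions are permuted as `θ` runs around the torus, so
together they trace a cycle in `Y_t`, over which the residue form pulls back to the sum of the
logarithmic derivatives `w s'(w) / s(w)`. By Lagrange inversion the coefficients of the latter are
constant terms, in `x₀`, of the powers of `f`; the sum over the `N` roots keeps only the exponents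
of `w` divisible by `N`, and integration over `θ` gives `Φ_f(t)`.

For the residue form, let `I` be the ideal generated by the logarithmic derivatives of `f`. Modulo
`I` the differential of `f` vanishes, so `f` is algebraic there: `P(f) ∈ I` for some `P ≠ 0`, that
is, `f` has finitely many critical values. As `f = 1/t` on `Y_t`, writing `P(f) = Σ bᵢ xᵢ ∂f/∂xᵢ`
gives a residue form whenever `P(1/t) ≠ 0`.

Near every small `t ≠ 0` the function `Φ_f` is thus a period, so `L` annihilates it in a punctured
neighbourhood of `0`, hence also its Taylor series.
-/

noncomputable section

namespace LaurentPencil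

section Algebra

open Polynomial TensorProduct

theorem formallySmooth_of_charZero (K L : Type*) [Field K] [CharZero K] [Field L] [Algebra K L] :
    Algebra.FormallySmooth K L := by
  obtain ⟨s, hs⟩ := exists_isTranscendenceBasis K L
  have : Algebra.IsAlgebraic (IntermediateField.adjoin K (Set.range ((↑) : s → L))) L :=
    hs.isAlgebraic_field
  exact .of_algebraicIndependent_of_isSeparable hs.1

theorem mapBaseChange_injective_of_formallySmooth (R S T : Type*) [CommRing R] [CommRing S]
    [CommRing T] [Algebra R S] [Algebra R T] [Algebra S T] [IsScalarTower R S T]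
    [Algebra.FormallySmooth S T] :
    Function.Injective (KaehlerDifferential.mapBaseChange R S T) := by
  rw [injective_iff_map_eq_zero]
  intro x hx
  obtain ⟨y, rfl⟩ := (Algebra.H1Cotangent.exact_δ_mapBaseChange R S T x).mp hx
  rw [Subsingleton.elim y 0, map_zero]

theorem D_algebraMap_X_ne_zero (R T : Type*) [CommRing R] [CommRing T] [Nontrivial T] [Algebra R T]
    [Algebra R[X] T] [IsScalarTower R R[X] T] [Algebra.FormallySmooth R[X] T] :
    KaehlerDifferential.D R T (algebraMap R[X] T X) ≠ 0 := by
  intro hD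
  have htmul : (1 : T) ⊗ₜ[R[X]] KaehlerDifferential.D R R[X] X = 0 :=
    mapBaseChange_injective_of_formallySmooth R R[X] T (by simp [hD])
  have h := congrArg (TensorProduct.rid R[X] T ∘
    (KaehlerDifferential.polynomialEquiv R).toLinearMap.lTensor T) htmul
  simp at h

/-- A transcendental element `a` of a `k`-algebra has a nonzero differential already in a field,
namely a residue field of `k(X) ⊗[k[X]] A`, where `X` acts as `a`. -/
theorem isAlgebraic_of_D_eq_zero {k A : Type*} [Field k] [CharZero k] [CommRing A] [Algebra k A]
    {a : A} (ha : KaehlerDifferential.D k A a = 0) : IsAlgebraic k a := by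
  by_contra htr
  let : Algebra k[X] A := (aeval a).toAlgebra
  have : IsScalarTower k k[X] A := .of_algebraMap_eq' (aeval a).comp_algebraMap.symm
  have hinj : Function.Injective (Algebra.linearMap k[X] A) :=
    transcendental_iff_injective.1 htr
  let K := FractionRing k[X]
  have : Nontrivial (K ⊗[k[X]] A) :=
    have := (TensorProduct.rid k[X] K).symm.injective.nontrivial
    (Module.Flat.lTensor_preserves_injective_linearMap (M := K) _ hinj).nontrivial
  obtain ⟨𝔪, h𝔪⟩ := Ideal.exists_maximal (K ⊗[k[X]] A)
  let L := (K ⊗[k[X]] A) ⧸ 𝔪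
  let : Field L := Ideal.Quotient.field 𝔪
  have : CharZero K := charZero_of_injective_algebraMap (IsFractionRing.injective k[X] K)
  have : Algebra.FormallySmooth K L := formallySmooth_of_charZero K L
  have : Algebra.FormallySmooth k[X] K := .of_isLocalization (nonZeroDivisors k[X])
  have : Algebra.FormallySmooth k[X] L := .comp k[X] K L
  let ψ : A →ₐ[k[X]] L := (Ideal.Quotient.mkₐ k[X] 𝔪).comp Algebra.TensorProduct.includeRight
  apply D_algebraMap_X_ne_zero k L
  let : Algebra A L := ψ.toRingHom.toAlgebra
  have : IsScalarTower k A L := .of_algebraMap_eq' (ψ.restrictScalars k).comp_algebraMap.symm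
  have hX : algebraMap k[X] L X = algebraMap A L a :=
    (ψ.commutes X).symm.trans (congrArg ψ (aeval_X a))
  rw [hX, ← KaehlerDifferential.map_D k k A L, ha, map_zero]

/-- The logarithmic partial derivative `x_i ∂/∂x_i`. -/
def eulerDeriv {R : Type} [CommRing R] {n : ℕ} (i : Fin n) :
    LaurentPoly R n →ₗ[R] LaurentPoly R n :=
  Finsupp.lsum R (fun a => (a i : R) • AddMonoidAlgebra.lsingle a) ∘ₗ
    (AddMonoidAlgebra.coeffLinearEquiv R).toLinearMap

theorem eulerDeriv_single {R : Type} [CommRing R] {n : ℕ} (i : Fin n) (a : Fin n → ℤ) (c : R) :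
    eulerDeriv i (AddMonoidAlgebra.single a c) = (a i : R) • AddMonoidAlgebra.single a c := by
  simp [eulerDeriv]

section Derivation

variable {R L M : Type*} [CommRing R] [CommRing L] [Algebra R L] [AddCommGroup M] [Module R M]
  [Module L M] {Γ : Type*} [AddCommGroup Γ]

/-- The logarithmic differential `a ↦ d(φ x^a) / φ x^a` on the group of exponents. -/
def logDifferential (d : Derivation R L M) (φ : AddMonoidAlgebra R Γ →ₐ[R] L) : Γ →+ M where
  toFun a := φ (.single (-a) 1) • d (φ (.single a 1))
  map_zero' := by simp [← AddMonoidAlgebra.one_def]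
  map_add' a b := by
    have h (a b : Γ) : φ (.single (a + b) 1) = φ (.single a 1) * φ (.single b 1) := by
      rw [← map_mul, AddMonoidAlgebra.single_mul_single, mul_one]
    have hinv (a : Γ) : φ (.single (-a) 1) * φ (.single a 1) = 1 := by
      rw [← h, neg_add_cancel, ← AddMonoidAlgebra.one_def, map_one]
    rw [neg_add, h, h, d.leibniz, smul_add, smul_smul, smul_smul, mul_right_comm, hinv, one_mul,
      mul_assoc, hinv, mul_one, add_comm]

theorem derivation_algHom_single [IsScalarTower R L M] (d : Derivation R L M)
    (φ : AddMonoidAlgebra R Γ →ₐ[R] L) (a : Γ) (c : R) :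
    d (φ (.single a c)) = φ (.single a c) • logDifferential d φ a := by
  have hinv : φ (.single a c) * φ (.single (-a) 1) = algebraMap R L c := by
    rw [← map_mul, AddMonoidAlgebra.single_mul_single, add_neg_cancel, mul_one,
      ← φ.commutes]
    rfl
  have hc : φ (.single a c) = c • φ (.single a 1) := by
    rw [← map_smul, AddMonoidAlgebra.smul_single, smul_eq_mul, mul_one]
  simp only [logDifferential, AddMonoidHom.coe_mk, ZeroHom.coe_mk]
  rw [smul_smul, hinv, hc, d.map_smul, algebraMap_smul]

end Derivation

variable {R : Type} {L M : Type*} [CommRing R] [CommRing L] [Algebra R L] [AddCommGroup M]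
  [Module R M] [Module L M] [IsScalarTower R L M] {n : ℕ}

theorem derivation_algHom_apply (d : Derivation R L M) (φ : LaurentPoly R n →ₐ[R] L)
    (f : LaurentPoly R n) :
    d (φ f) = ∑ i, φ (eulerDeriv i f) • logDifferential d φ (Pi.single i 1) := by
  induction f using AddMonoidAlgebra.induction_linear with
  | zero => simp
  | add f g hf hg => simp only [map_add, hf, hg, add_smul, Finset.sum_add_distrib]
  | single a c =>
    have ha : logDifferential d φ a = ∑ i, a i • logDifferential d φ (Pi.single i 1) := by
      conv_lhs => rw [pi_eq_sum_univ' a, map_sum]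
      exact Finset.sum_congr rfl fun i _ => map_zsmul ..
    rw [derivation_algHom_single, ha, Finset.smul_sum]
    refine Finset.sum_congr rfl fun i _ => ?_
    rw [eulerDeriv_single, map_smul, smul_assoc, Int.cast_smul_eq_zsmul, smul_comm]

theorem derivation_algHom_eq_zero (d : Derivation R L M) (φ : LaurentPoly R n →ₐ[R] L)
    {f : LaurentPoly R n} (hf : ∀ i, φ (eulerDeriv i f) = 0) : d (φ f) = 0 := by
  simp only [derivation_algHom_apply, hf, zero_smul, Finset.sum_const_zero]

/-- The differential of `f` vanishes modulo the ideal, so `f` is algebraic there: `f` has finitely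
many critical values on the torus. -/
theorem exists_aeval_mem_span_eulerDeriv {k : Type} [Field k] [CharZero k] {n : ℕ}
    (f : LaurentPoly k n) :
    ∃ P : k[X], P ≠ 0 ∧ aeval f P ∈ Ideal.span (Set.range fun i => eulerDeriv i f) := by
  set J := Ideal.span (Set.range fun i => eulerDeriv i f)
  have hD : KaehlerDifferential.D k (LaurentPoly k n ⧸ J) (Ideal.Quotient.mkₐ k J f) = 0 := by
    refine derivation_algHom_eq_zero _ _ fun i => ?_
    exact Ideal.Quotient.eq_zero_iff_mem.2 (Ideal.subset_span ⟨i, rfl⟩)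
  obtain ⟨P, hP, hfP⟩ := isAlgebraic_of_D_eq_zero hD
  rw [aeval_algHom_apply] at hfP
  exact ⟨P, hP, Ideal.Quotient.eq_zero_iff_mem.1 hfP⟩

end Algebra

section Evaluation

variable {n : ℕ} {x : Fin n → ℂ}

theorem monom_add (hx : ∀ i, x i ≠ 0) (a b : Fin n → ℤ) :
    monom (a + b) x = monom a x * monom b x := by
  simp [monom, zpow_add₀ (hx _), Finset.prod_mul_distrib]

theorem eval_add (f g : LaurentPoly ℂ n) (x : Fin n → ℂ) :
    eval (f + g) x = eval f x + eval g x := by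
  rw [eval, AddMonoidAlgebra.coeff_add, Finsupp.sum_add_index' (by simp) (by simp [add_mul])]
  rfl

theorem eval_single (a : Fin n → ℤ) (c : ℂ) (x : Fin n → ℂ) :
    eval (AddMonoidAlgebra.single a c) x = c * monom a x := by
  simp [eval]

/-- Evaluation of Laurent polynomials at a point of the torus, as an algebra homomorphism. -/
def evalHom (x : Fin n → ℂ) (hx : ∀ i, x i ≠ 0) : LaurentPoly ℂ n →ₐ[ℂ] ℂ :=
  AddMonoidAlgebra.lift ℂ ℂ (Fin n → ℤ)
    { toFun := fun a => monom a.toAdd x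
      map_one' := by simp [monom]
      map_mul' := fun a b => monom_add hx _ _ }

theorem evalHom_apply (hx : ∀ i, x i ≠ 0) (f : LaurentPoly ℂ n) : evalHom x hx f = eval f x := by
  simp [evalHom, AddMonoidAlgebra.lift_apply, eval]

theorem eval_pow (hx : ∀ i, x i ≠ 0) (f : LaurentPoly ℂ n) (k : ℕ) :
    eval (f ^ k) x = eval f x ^ k := by
  simp only [← evalHom_apply hx, map_pow]

theorem hasFDerivAt_monom (hx : ∀ i, x i ≠ 0) (a : Fin n → ℤ) :
    HasFDerivAt (monom a) (∑ i, ((a i : ℂ) * monom a x * (x i)⁻¹) •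
      (ContinuousLinearMap.proj i : (Fin n → ℂ) →L[ℂ] ℂ)) x := by
  have h := HasFDerivAt.finsetProd (u := Finset.univ) fun i _ =>
    (hasDerivAt_zpow (a i) (x i) (.inl (hx i))).comp_hasFDerivAt x
      (ContinuousLinearMap.proj i : (Fin n → ℂ) →L[ℂ] ℂ).hasFDerivAt
  refine h.congr_fderiv (Finset.sum_congr rfl fun i _ => ?_)
  rw [smul_smul, monom, ← Finset.mul_prod_erase _ _ (Finset.mem_univ i), zpow_sub_one₀ (hx i)]
  congr 1
  simp only [Function.comp_apply, ContinuousLinearMap.proj_apply]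
  ring

theorem hasFDerivAt_eval (hx : ∀ i, x i ≠ 0) (f : LaurentPoly ℂ n) :
    HasFDerivAt (eval f) (∑ i, (eval (eulerDeriv i f) x * (x i)⁻¹) •
      (ContinuousLinearMap.proj i : (Fin n → ℂ) →L[ℂ] ℂ)) x := by
  induction f using AddMonoidAlgebra.induction_linear with
  | zero =>
    rw [show eval (0 : LaurentPoly ℂ n) = 0 from funext fun _ => by simp [eval]]
    refine (hasFDerivAt_const (0 : ℂ) x).congr_fderiv ?_
    ext v
    simp [eval]
  | add f g hf hg =>
    rw [show eval (f + g) = eval f + eval g from funext (eval_add f g)]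
    refine (hf.add hg).congr_fderiv ?_
    ext v
    simp [eval_add, add_mul, Finset.sum_add_distrib]
  | single a c =>
    rw [show eval (.single a c) = fun x => c * monom a x from funext (eval_single a c)]
    refine ((hasFDerivAt_monom hx a).const_mul c).congr_fderiv ?_
    simp only [eulerDeriv_single, AddMonoidAlgebra.smul_single, eval_single, Finset.smul_sum,
      smul_smul, smul_eq_mul]
    exact Finset.sum_congr rfl fun i _ => by ring_nf

theorem fderiv_pencilFun (hx : ∀ i, x i ≠ 0) (f : LaurentPoly ℂ n) (t : ℂ) (v : Fin n → ℂ) :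
    fderiv ℂ (pencilFun f t) x v = -t * ∑ i, eval (eulerDeriv i f) x * ((x i)⁻¹ * v i) := by
  have h : HasFDerivAt (pencilFun f t) _ x := ((hasFDerivAt_eval hx f).const_mul t).const_sub 1
  simp [h.fderiv, mul_assoc]

end Evaluation

section ResidueForm

open Polynomial Filter Topology

theorem wedgeCovector_sum_smul {n k : ℕ} {ι : Type*} (s : Finset ι) (α : (Fin n → ℂ) →ₗ[ℂ] ℂ)
    (c : ι → ℂ) (η : ι → (Fin n → ℂ) [⋀^Fin k]→ₗ[ℂ] ℂ) :
    wedgeCovector α (∑ i ∈ s, c i • η i) = ∑ i ∈ s, c i • wedgeCovector α (η i) := by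
  let wedge := AlternatingMap.alternatizeUncurryFinLM ∘ₗ
    LinearMap.smulRightₗ (R := ℂ) (M := (Fin n → ℂ) [⋀^Fin k]→ₗ[ℂ] ℂ) α
  change wedge _ = ∑ i ∈ s, c i • wedge (η i)
  simp only [map_sum, map_smul]

variable {m : ℕ} {x : Fin (m + 1) → ℂ}

/-- This is the Laplace expansion, along the column number `i`, of the logarithmic Jacobian matrix
`v_j k / x_k` with that column replaced by `α (v_j)`. -/
theorem wedgeCovector_dlogOmit (hx : ∀ k, x k ≠ 0) (i : Fin (m + 1))
    (α : (Fin (m + 1) → ℂ) →ₗ[ℂ] ℂ) :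
    wedgeCovector α (dlogOmit m i x) =
      ((-1) ^ (i : ℕ) * (α (Pi.single i 1) * x i)) • dlogVol (m + 1) x := by
  ext v
  let M : Matrix (Fin (m + 1)) (Fin (m + 1)) ℂ := fun j k => (x k)⁻¹ * v j k
  have hα (j) : α (v j) = ∑ k, (α (Pi.single k 1) * x k) • M j k := by
    conv_lhs => rw [pi_eq_sum_univ' (v j), map_sum]
    refine Finset.sum_congr rfl fun k _ => ?_
    simp only [map_smul, M, smul_eq_mul]
    field_simp [hx k]
  have hdet := Matrix.det_updateCol_sum M i fun k => α (Pi.single k 1) * x k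
  simp only [← hα] at hdet
  have hminor (j : Fin (m + 1)) : ((M.updateCol i fun k => α (v k)).submatrix j.succAbove
      i.succAbove).det = dlogOmit m i x (j.removeNth v) := by
    change _ = Matrix.det _
    congr 1
    ext p q
    rw [Matrix.submatrix_apply, Matrix.updateCol_ne (Fin.succAbove_ne i q)]
    rfl
  have hvol : dlogVol (m + 1) x v = M.det := rfl
  rw [AlternatingMap.smul_apply, hvol, mul_smul, ← hdet, Matrix.det_succ_column _ i,
    wedgeCovector, AlternatingMap.alternatizeUncurryFin_apply, Finset.smul_sum]
  refine Finset.sum_congr rfl fun j _ => ?_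
  have hsign : (-1 : ℂ) ^ (i : ℕ) * (-1) ^ (i : ℕ) = 1 := by rw [← mul_pow]; simp
  simp only [hminor, LinearMap.smulRight_apply, AlternatingMap.smul_apply, Matrix.updateCol_self,
    smul_eq_mul, zsmul_eq_mul, Int.cast_pow, Int.cast_neg, Int.cast_one, pow_add]
  linear_combination (-(-1 : ℂ) ^ (j : ℕ) * (α (v j) * dlogOmit m i x (j.removeNth v))) * hsign

/-- The form `(2πi)^{-m} ∑ᵢ (-1)^{i+1} bᵢ / (t P(1/t)) ⋀_{k ≠ i} dx_k/x_k`. When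
`∑ᵢ bᵢ xᵢ ∂f/∂xᵢ = P(f)`, it is the residue form of the pencil of `f`, because `f = 1/t` on `Y_t`.
Numerator and denominator are multiplied by `t ^ deg P` to make them polynomial in `t`. -/
def residueForm (P : ℂ[X]) (hP : P ≠ 0) (b : Fin (m + 1) → LaurentPoly ℂ (m + 1)) :
    RelativeForm m where
  den := C ((2 * (Real.pi : ℂ) * Complex.I) ^ m) * (X * P.reverse)
  den_ne_zero := by simp [hP, Real.pi_ne_zero]
  num i := .ofCoeff <|
    (b i).coeff.mapRange (fun c => C ((-1) ^ ((i : ℕ) + 1) * c) * X ^ P.natDegree) (by simp)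

theorem eval_reverse_eq {t : ℂ} (ht : t ≠ 0) (P : ℂ[X]) :
    P.reverse.eval t = t ^ P.natDegree * P.eval t⁻¹ := by
  have : Invertible t⁻¹ := invertibleOfNonzero (inv_ne_zero ht)
  have h := eval₂_reverse_mul_pow (RingHom.id ℂ) t⁻¹ P
  rw [invOf_eq_inv, inv_inv, eval₂_id, eval₂_id] at h
  rw [← h, inv_pow]
  field_simp

theorem residueForm_at {t : ℂ} (ht : t ≠ 0) {P : ℂ[X]} (hP : P ≠ 0)
    (b : Fin (m + 1) → LaurentPoly ℂ (m + 1)) (x : Fin (m + 1) → ℂ) :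
    (residueForm P hP b).at t x = ∑ i : Fin (m + 1), ((-1) ^ ((i : ℕ) + 1) *
      LaurentPencil.eval (b i) x / ((2 * (Real.pi : ℂ) * Complex.I) ^ m * (t * P.eval t⁻¹))) •
        dlogOmit m i x := by
  have hnum (i : Fin (m + 1)) : (((residueForm P hP b).num i).coeff.sum
      fun a p => p.eval t * monom a x) =
      t ^ P.natDegree * ((-1) ^ ((i : ℕ) + 1) * LaurentPencil.eval (b i) x) := by
    simp only [residueForm]
    rw [Finsupp.sum_mapRange_index (by simp), LaurentPencil.eval, Finsupp.mul_sum, Finsupp.mul_sum]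
    refine Finsupp.sum_congr fun a _ => ?_
    simp only [eval_mul, eval_C, Polynomial.eval_pow, eval_X]
    ring
  have hden : (residueForm P hP b).den.eval t =
      t ^ P.natDegree * ((2 * (Real.pi : ℂ) * Complex.I) ^ m * (t * P.eval t⁻¹)) := by
    simp only [residueForm, eval_mul, eval_C, eval_X, eval_reverse_eq ht]
    ring
  simp only [RelativeForm.at, hnum, hden, mul_div_mul_left _ _ (pow_ne_zero P.natDegree ht)]

theorem isResidueAt_residueForm {f : LaurentPoly ℂ (m + 1)} {P : ℂ[X]} (hP : P ≠ 0)
    {b : Fin (m + 1) → LaurentPoly ℂ (m + 1)} (hb : ∑ i, b i * eulerDeriv i f = aeval f P) {t : ℂ}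
    (ht : t ≠ 0) (hPt : P.eval t⁻¹ ≠ 0) : IsResidueAt f (residueForm P hP b) t := by
  rintro x ⟨hx, hxt⟩
  have hfx : eval f x = t⁻¹ := by
    rw [pencilFun, sub_eq_zero] at hxt
    exact eq_inv_of_mul_eq_one_right hxt.symm
  have hsum : ∑ i, LaurentPencil.eval (b i) x * LaurentPencil.eval (eulerDeriv i f) x =
      P.eval t⁻¹ := by
    have h := congrArg (evalHom x hx) hb
    rw [map_sum, ← aeval_algHom_apply, evalHom_apply, hfx] at h
    simpa only [map_mul, evalHom_apply, coe_aeval_eq_eval] using h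
  have hdF (i) : fderiv ℂ (pencilFun f t) x (Pi.single i 1) * x i =
      -(t * LaurentPencil.eval (eulerDeriv i f) x) := by
    simp [fderiv_pencilFun hx, Pi.single_apply, hx i, mul_assoc]
  simp only [residueForm_at ht, wedgeCovector_sum_smul, wedgeCovector_dlogOmit hx,
    ContinuousLinearMap.coe_coe, hdF, smul_smul, ← Finset.sum_smul]
  congr 1
  have hterm (i : Fin (m + 1)) : (-1) ^ ((i : ℕ) + 1) * LaurentPencil.eval (b i) x /
      ((2 * (Real.pi : ℂ) * Complex.I) ^ m * (t * P.eval t⁻¹)) *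
      ((-1) ^ (i : ℕ) * -(t * LaurentPencil.eval (eulerDeriv i f) x)) =
      ((2 * (Real.pi : ℂ) * Complex.I) ^ m)⁻¹ * (P.eval t⁻¹)⁻¹ *
      (LaurentPencil.eval (b i) x * LaurentPencil.eval (eulerDeriv i f) x) := by
    have hsign : (-1 : ℂ) ^ (i : ℕ) * (-1) ^ (i : ℕ) = 1 := by rw [← mul_pow]; simp
    generalize P.eval t⁻¹ = p at hPt
    field_simp
    linear_combination (LaurentPencil.eval (b i) x * LaurentPencil.eval (eulerDeriv i f) x) * hsign
  rw [Finset.sum_congr rfl fun i _ => hterm i, ← Finset.mul_sum, hsum, inv_mul_cancel_right₀ hPt]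

theorem exists_residueForm (f : LaurentPoly ℂ (m + 1)) :
    ∃ ω : RelativeForm m, ∀ᶠ t in 𝓝[≠] 0, IsResidueAt f ω t := by
  obtain ⟨P, hP, hmem⟩ := exists_aeval_mem_span_eulerDeriv f
  obtain ⟨b, hb⟩ := Ideal.mem_span_range_iff_exists_fun.1 hmem
  have hroots : ∀ᶠ s in Bornology.cobounded ℂ, P.eval s ≠ 0 := by
    filter_upwards [(Multiset.finite_toSet P.roots).isBounded] with s hs h
    exact hs ((mem_roots hP).2 h)
  refine ⟨residueForm P hP b, ?_⟩
  filter_upwards [tendsto_inv₀_nhdsNE_zero.eventually hroots, self_mem_nhdsWithin] with t hPt ht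
  exact isResidueAt_residueForm hP hb ht hPt

end ResidueForm

section LagrangeInversion

open Metric Set Filter Topology
open scoped ContDiff

theorem hasSum_circleIntegral_div_pow {g : ℂ → ℂ} {R : ℝ}
    (hg : DifferentiableOn ℂ g (closedBall 0 R)) {w : ℂ} (hw : ‖w‖ < R) :
    HasSum (fun n : ℕ => ∮ z in C(0, R), (w / z) ^ n * (z⁻¹ * g z))
      (2 * Real.pi * Complex.I * g w) := by
  have hR : 0 ≤ R := (norm_nonneg w).trans hw.le
  have h := hasSum_two_pi_I_cauchyPowerSeries_integral (c := 0) (w := w)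
    ((hg.continuousOn.mono sphere_subset_closedBall).circleIntegrable hR) hw
  rw [zero_add, hg.circleIntegral_sub_inv_smul (mem_ball_zero_iff.2 hw)] at h
  simpa only [sub_zero, smul_eq_mul] using h

theorem continuousOn_deriv_of_contDiffOn {E F : Type*} [NormedAddCommGroup E] [NormedSpace ℝ E]
    [NormedAddCommGroup F] [NormedSpace ℂ F] {g : E × ℂ → F} {U : Set (E × ℂ)} (hU : IsOpen U)
    (hg : ContDiffOn ℝ 1 g U) (hd : ∀ p ∈ U, DifferentiableAt ℂ (fun z => g (p.1, z)) p.2) :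
    ContinuousOn (fun p : E × ℂ => deriv (fun z => g (p.1, z)) p.2) U := by
  have hfderiv (p) (hp : p ∈ U) : fderiv ℝ g p (0, 1) = deriv (fun z => g (p.1, z)) p.2 := by
    have hgp := ((hg.differentiableOn one_ne_zero).differentiableAt (hU.mem_nhds hp)).hasFDerivAt
    have hpartial := hgp.comp p.2 (hasFDerivAt_prodMk_right (𝕜 := ℝ) p.1 p.2)
    have h := hpartial.unique ((hd p hp).hasDerivAt.hasFDerivAt.restrictScalars ℝ)
    simpa using DFunLike.congr_fun h 1
  exact ((hg.continuousOn_fderiv_of_isOpen hU le_rfl).clm_apply continuousOn_const).congr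
    fun p hp => (hfderiv p hp).symm

/-- Bounds under which the equation `s = w * φ s` of Lagrange inversion has exactly one solution in
the disc `‖s‖ < 1 / 2` for each `w` in the disc `‖w‖ < 1 / 8`. -/
structure IsLagrangeKernel (φ : ℂ → ℂ) : Prop where
  differentiableOn : DifferentiableOn ℂ φ (ball 0 1)
  ne_zero : ∀ s ∈ ball (0 : ℂ) 1, φ s ≠ 0
  norm_le : ∀ s ∈ ball (0 : ℂ) 1, ‖φ s‖ ≤ 2

open Classical in
/-- The solution `s` of `s = w * φ s` in the disc `‖s‖ < 1 / 2`; as a function of `w` it is inverse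
to `s ↦ s / φ s`. -/
def lagrangeInverse (φ : ℂ → ℂ) (w : ℂ) : ℂ :=
  if h : ∃ s ∈ ball (0 : ℂ) (1 / 2), s = w * φ s then h.choose else 0

/-- The logarithmic derivative `w s' / s` of the solution `s` of `s = w * φ s`, in a form that is
regular at `w = 0`. -/
def lagrangeLogDeriv (φ : ℂ → ℂ) (w : ℂ) : ℂ := (1 - w * deriv φ (lagrangeInverse φ w))⁻¹

theorem mem_ball_one_of_mem_ball_half {s : ℂ} (hs : s ∈ ball (0 : ℂ) (1 / 2)) :
    s ∈ ball (0 : ℂ) 1 :=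
  ball_subset_ball (by norm_num) hs

namespace IsLagrangeKernel

variable {φ : ℂ → ℂ} (hφ : IsLagrangeKernel φ) {w : ℂ}
include hφ

theorem hasDerivAt {s : ℂ} (hs : s ∈ ball (0 : ℂ) (1 / 2)) : HasDerivAt φ (deriv φ s) s :=
  (hφ.differentiableOn.differentiableAt
    (isOpen_ball.mem_nhds (mem_ball_one_of_mem_ball_half hs))).hasDerivAt

theorem norm_deriv_le {s : ℂ} (hs : s ∈ ball (0 : ℂ) (1 / 2)) : ‖deriv φ s‖ ≤ 4 := by
  have hsub : closedBall s (1 / 2) ⊆ ball 0 1 :=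
    closedBall_subset_ball' (by rw [mem_ball] at hs; linarith)
  have h := Complex.norm_deriv_le_of_forall_mem_sphere_norm_le (by norm_num : (0 : ℝ) < 1 / 2)
    (hφ.differentiableOn.diffContOnCl_ball hsub)
    fun z hz => hφ.norm_le z (hsub (sphere_subset_closedBall hz))
  norm_num at h
  exact h

theorem norm_mul_sub_mul_le (hw : ‖w‖ < 1 / 8) {s₁ s₂ : ℂ} (h₁ : s₁ ∈ ball (0 : ℂ) (1 / 2))
    (h₂ : s₂ ∈ ball (0 : ℂ) (1 / 2)) : ‖w * φ s₁ - w * φ s₂‖ ≤ 1 / 2 * ‖s₁ - s₂‖ := by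
  have h := (convex_ball (0 : ℂ) (1 / 2)).norm_image_sub_le_of_norm_hasDerivWithin_le
    (fun s hs => (hφ.hasDerivAt hs).hasDerivWithinAt) (fun s hs => hφ.norm_deriv_le hs) h₂ h₁
  calc ‖w * φ s₁ - w * φ s₂‖ = ‖w‖ * ‖φ s₁ - φ s₂‖ := by rw [← mul_sub, norm_mul]
    _ ≤ 1 / 8 * (4 * ‖s₁ - s₂‖) := by gcongr
    _ = 1 / 2 * ‖s₁ - s₂‖ := by ring

theorem exists_eq_mul (hw : ‖w‖ < 1 / 8) : ∃ s ∈ ball (0 : ℂ) (1 / 2), s = w * φ s := by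
  have hsub : closedBall (0 : ℂ) (1 / 4) ⊆ ball 0 (1 / 2) := closedBall_subset_ball (by norm_num)
  have hmaps : MapsTo (fun s => w * φ s) (closedBall (0 : ℂ) (1 / 4)) (closedBall 0 (1 / 4)) := by
    intro s hs
    rw [mem_closedBall_zero_iff, norm_mul]
    calc ‖w‖ * ‖φ s‖ ≤ 1 / 8 * 2 := by
          gcongr
          exact hφ.norm_le s (mem_ball_one_of_mem_ball_half (hsub hs))
      _ = 1 / 4 := by norm_num
  have hcontr : ContractingWith (1 / 2) (hmaps.restrict _ _ _) := by
    refine ⟨by norm_num, LipschitzWith.of_dist_le_mul fun s₁ s₂ => ?_⟩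
    simpa [Subtype.dist_eq, dist_eq_norm] using
      hφ.norm_mul_sub_mul_le hw (hsub s₁.2) (hsub s₂.2)
  obtain ⟨s, hs, hfix, -⟩ := hcontr.exists_fixedPoint' isClosed_closedBall.isComplete hmaps
    (mem_closedBall_self (by norm_num)) (edist_ne_top 0 _)
  exact ⟨s, hsub hs, hfix.symm⟩

theorem lagrangeInverse_mem_ball (hw : ‖w‖ < 1 / 8) :
    lagrangeInverse φ w ∈ ball (0 : ℂ) (1 / 2) := by
  rw [lagrangeInverse, dif_pos (hφ.exists_eq_mul hw)]
  exact (hφ.exists_eq_mul hw).choose_spec.1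

theorem lagrangeInverse_eq_mul (hw : ‖w‖ < 1 / 8) :
    lagrangeInverse φ w = w * φ (lagrangeInverse φ w) := by
  rw [lagrangeInverse, dif_pos (hφ.exists_eq_mul hw)]
  exact (hφ.exists_eq_mul hw).choose_spec.2

theorem eq_lagrangeInverse (hw : ‖w‖ < 1 / 8) {s : ℂ} (hs : s ∈ ball (0 : ℂ) (1 / 2))
    (hsw : s = w * φ s) : s = lagrangeInverse φ w := by
  have h := hφ.norm_mul_sub_mul_le hw hs (hφ.lagrangeInverse_mem_ball hw)
  rw [← hsw, ← hφ.lagrangeInverse_eq_mul hw] at h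
  exact sub_eq_zero.1 (norm_le_zero_iff.1 (by linarith))

theorem apply_lagrangeInverse_ne_zero (hw : ‖w‖ < 1 / 8) : φ (lagrangeInverse φ w) ≠ 0 :=
  hφ.ne_zero _ (mem_ball_one_of_mem_ball_half (hφ.lagrangeInverse_mem_ball hw))

theorem lagrangeInverse_ne_zero (hw : ‖w‖ < 1 / 8) (hw₀ : w ≠ 0) : lagrangeInverse φ w ≠ 0 := by
  rw [hφ.lagrangeInverse_eq_mul hw]
  exact mul_ne_zero hw₀ (hφ.apply_lagrangeInverse_ne_zero hw)

theorem half_le_norm_one_sub_mul_deriv (hw : ‖w‖ < 1 / 8) {s : ℂ}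
    (hs : s ∈ ball (0 : ℂ) (1 / 2)) : 1 / 2 ≤ ‖1 - w * deriv φ s‖ := by
  have h : ‖w * deriv φ s‖ ≤ 1 / 8 * 4 := by
    rw [norm_mul]
    gcongr
    exact hφ.norm_deriv_le hs
  have := norm_sub_norm_le (1 : ℂ) (w * deriv φ s)
  rw [norm_one] at this
  linarith

theorem one_sub_mul_deriv_ne_zero (hw : ‖w‖ < 1 / 8) {s : ℂ} (hs : s ∈ ball (0 : ℂ) (1 / 2)) :
    1 - w * deriv φ s ≠ 0 :=
  norm_pos_iff.1 (one_half_pos.trans_le (hφ.half_le_norm_one_sub_mul_deriv hw hs))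

theorem norm_lagrangeLogDeriv_le (hw : ‖w‖ < 1 / 8) : ‖lagrangeLogDeriv φ w‖ ≤ 2 := by
  rw [lagrangeLogDeriv, norm_inv]
  exact inv_le_of_inv_le₀ two_pos (by
    simpa using hφ.half_le_norm_one_sub_mul_deriv hw (hφ.lagrangeInverse_mem_ball hw))

end IsLagrangeKernel

section Parameters

variable {E : Type*} [NormedAddCommGroup E] [NormedSpace ℝ E] {φ : E → ℂ → ℂ}
  (hsmooth : ContDiffOn ℝ ∞ (Function.uncurry φ) (univ ×ˢ ball 0 1))
include hsmooth

theorem contDiffAt_sub_mul_uncurry (θ : E) (w : ℂ) {s : ℂ} (hs : s ∈ ball (0 : ℂ) (1 / 2)) :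
    ContDiffAt ℝ ∞ (fun q : (E × ℂ) × ℂ => q.2 - q.1.2 * φ q.1.1 q.2) ((θ, w), s) := by
  have hφs : ContDiffAt ℝ ∞ (Function.uncurry φ) (θ, s) := hsmooth.contDiffAt
    ((isOpen_univ.prod isOpen_ball).mem_nhds ⟨mem_univ θ, mem_ball_one_of_mem_ball_half hs⟩)
  have hcomp : ContDiffAt ℝ ∞ (fun q : (E × ℂ) × ℂ => φ q.1.1 q.2) ((θ, w), s) :=
    ContDiffAt.comp (g := Function.uncurry φ) (f := fun q : (E × ℂ) × ℂ => (q.1.1, q.2))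
      ((θ, w), s) hφs (by fun_prop)
  exact contDiffAt_snd.sub ((contDiffAt_snd.comp ((θ, w), s) contDiffAt_fst).mul hcomp)

variable (hφ : ∀ θ, IsLagrangeKernel (φ θ))
include hφ

theorem isInvertible_fderiv_sub_mul_uncurry (θ : E) {w : ℂ} (hw : ‖w‖ < 1 / 8) {s : ℂ}
    (hs : s ∈ ball (0 : ℂ) (1 / 2)) :
    (fderiv ℝ (fun q : (E × ℂ) × ℂ => q.2 - q.1.2 * φ q.1.1 q.2) ((θ, w), s) ∘L
      .inr ℝ (E × ℂ) ℂ).IsInvertible := by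
  have hpartial := ((contDiffAt_sub_mul_uncurry hsmooth θ w hs).differentiableAt
    (by simp)).hasFDerivAt.comp s (hasFDerivAt_prodMk_right (𝕜 := ℝ) (θ, w) s)
  have hderiv : HasDerivAt (fun s => s - w * φ θ s) (1 - w * deriv (φ θ) s) s :=
    (hasDerivAt_id s).sub (((hφ θ).hasDerivAt hs).const_mul w)
  rw [hpartial.unique (hderiv.hasFDerivAt.restrictScalars ℝ)]
  refine ⟨((ContinuousLinearEquiv.unitsEquivAut ℂ)
    (Units.mk0 _ ((hφ θ).one_sub_mul_deriv_ne_zero hw hs))).restrictScalars ℝ, ?_⟩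
  ext
  simp

theorem contDiffAt_lagrangeInverse [CompleteSpace E] (θ : E) {w : ℂ} (hw : ‖w‖ < 1 / 8) :
    ContDiffAt ℝ ∞ (fun p : E × ℂ => lagrangeInverse (φ p.1) p.2) (θ, w) := by
  have hs := (hφ θ).lagrangeInverse_mem_ball hw
  have hF := contDiffAt_sub_mul_uncurry hsmooth θ w hs
  have hinv := isInvertible_fderiv_sub_mul_uncurry hsmooth hφ θ hw hs
  have hne : (∞ : WithTop ℕ∞) ≠ 0 := by simp
  have hsol := hF.contDiffAt_implicitFunction hne hinv
  have hball : ∀ᶠ p in 𝓝 (θ, w), hF.implicitFunction hne hinv p ∈ ball (0 : ℂ) (1 / 2) :=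
    hsol.continuousAt.eventually_mem (isOpen_ball.mem_nhds (by
      rwa [hF.implicitFunction_apply_self hne hinv]))
  have hnorm : ∀ᶠ p : E × ℂ in 𝓝 (θ, w), ‖p.2‖ < 1 / 8 :=
    continuous_snd.norm.continuousAt.eventually_lt continuousAt_const hw
  refine hsol.congr_of_eventuallyEq ?_
  filter_upwards [hball, hnorm, hF.eventually_apply_implicitFunction hne hinv] with p h₁ h₂ h₃
  rw [← (hφ θ).lagrangeInverse_eq_mul hw, sub_self, sub_eq_zero] at h₃
  exact ((hφ p.1).eq_lagrangeInverse h₂ h₁ h₃).symm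

theorem continuousAt_lagrangeLogDeriv [CompleteSpace E] (θ : E) {w : ℂ} (hw : ‖w‖ < 1 / 8) :
    ContinuousAt (fun p : E × ℂ => lagrangeLogDeriv (φ p.1) p.2) (θ, w) := by
  have hs := (hφ θ).lagrangeInverse_mem_ball hw
  have hopen : IsOpen ((univ : Set E) ×ˢ ball (0 : ℂ) 1) := isOpen_univ.prod isOpen_ball
  have hderiv := (continuousOn_deriv_of_contDiffOn hopen
    (hsmooth.of_le (by exact_mod_cast le_top)) fun p hp =>
      (hφ p.1).differentiableOn.differentiableAt (isOpen_ball.mem_nhds hp.2)).continuousAt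
    (hopen.mem_nhds (x := (θ, lagrangeInverse (φ θ) w))
      ⟨mem_univ θ, mem_ball_one_of_mem_ball_half hs⟩)
  have hinv := (contDiffAt_lagrangeInverse hsmooth hφ θ hw).continuousAt
  have hcomp : ContinuousAt (fun p : E × ℂ => deriv (φ p.1) (lagrangeInverse (φ p.1) p.2))
      (θ, w) :=
    ContinuousAt.comp (g := fun p : E × ℂ => deriv (φ p.1) p.2)
      (f := fun p : E × ℂ => (p.1, lagrangeInverse (φ p.1) p.2)) hderiv
      (continuousAt_fst.prodMk hinv)
  exact (continuousAt_const.sub (continuousAt_snd.mul hcomp)).inv₀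
    ((hφ θ).one_sub_mul_deriv_ne_zero hw hs)

end Parameters

namespace IsLagrangeKernel

variable {φ : ℂ → ℂ} (hφ : IsLagrangeKernel φ) {w : ℂ}
include hφ

theorem continuousAt_lagrangeInverse (hw : ‖w‖ < 1 / 8) :
    ContinuousAt (lagrangeInverse φ) w := by
  have hsmooth : ContDiffOn ℝ ∞ (Function.uncurry fun _ : ℂ => φ) (univ ×ˢ ball 0 1) :=
    ((hφ.differentiableOn.contDiffOn isOpen_ball).restrict_scalars ℝ).comp contDiffOn_snd
      fun p hp => hp.2
  exact ContinuousAt.comp (f := fun w => ((0 : ℂ), w))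
    (contDiffAt_lagrangeInverse hsmooth (fun _ => hφ) 0 hw).continuousAt (by fun_prop)

theorem hasDerivAt_lagrangeInverse (hw : ‖w‖ < 1 / 8) :
    HasDerivAt (lagrangeInverse φ) (φ (lagrangeInverse φ w) * lagrangeLogDeriv φ w) w := by
  have hs := hφ.lagrangeInverse_mem_ball hw
  have hφs := hφ.apply_lagrangeInverse_ne_zero hw
  have hone := hφ.one_sub_mul_deriv_ne_zero hw hs
  have hw_eq : lagrangeInverse φ w = w * φ (lagrangeInverse φ w) := hφ.lagrangeInverse_eq_mul hw
  have hquot := (hasDerivAt_id (lagrangeInverse φ w)).div (hφ.hasDerivAt hs) hφs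
  have hval : (1 * φ (lagrangeInverse φ w) - lagrangeInverse φ w * deriv φ (lagrangeInverse φ w)) /
      φ (lagrangeInverse φ w) ^ 2 =
      (1 - w * deriv φ (lagrangeInverse φ w)) / φ (lagrangeInverse φ w) := by
    rw [div_eq_div_iff (pow_ne_zero 2 hφs) hφs]
    linear_combination
      (-deriv φ (lagrangeInverse φ w) * φ (lagrangeInverse φ w)) * hw_eq
  refine (HasDerivAt.of_local_left_inverse (hφ.continuousAt_lagrangeInverse hw)
    (hquot.congr_deriv hval) (div_ne_zero hone hφs) ?_).congr_deriv ?_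
  · have hnorm : ∀ᶠ z : ℂ in 𝓝 w, ‖z‖ < 1 / 8 :=
      continuous_norm.continuousAt.eventually_lt continuousAt_const hw
    filter_upwards [hnorm] with z hz
    exact (div_eq_iff (hφ.apply_lagrangeInverse_ne_zero hz)).2 (hφ.lagrangeInverse_eq_mul hz)
  · rw [inv_div, lagrangeLogDeriv, div_eq_mul_inv]

theorem hasDerivAt_lagrangeInverse_of_ne_zero (hw : ‖w‖ < 1 / 8) (hw₀ : w ≠ 0) :
    HasDerivAt (lagrangeInverse φ) (lagrangeInverse φ w * (w⁻¹ * lagrangeLogDeriv φ w)) w := by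
  refine (hφ.hasDerivAt_lagrangeInverse hw).congr_deriv ?_
  conv_rhs => rw [hφ.lagrangeInverse_eq_mul hw]
  field_simp

theorem differentiableOn_lagrangeLogDeriv :
    DifferentiableOn ℂ (lagrangeLogDeriv φ) (ball 0 (1 / 8)) := by
  intro w hw
  rw [mem_ball_zero_iff] at hw
  have hs := hφ.lagrangeInverse_mem_ball hw
  have hderiv : DifferentiableAt ℂ (deriv φ) (lagrangeInverse φ w) :=
    (hφ.differentiableOn.deriv isOpen_ball).differentiableAt
      (isOpen_ball.mem_nhds (mem_ball_one_of_mem_ball_half hs))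
  have hcomp := hderiv.comp w (hφ.hasDerivAt_lagrangeInverse hw).differentiableAt
  exact (((differentiableAt_const 1).sub (differentiableAt_id.mul hcomp)).inv
    (hφ.one_sub_mul_deriv_ne_zero hw hs)).differentiableWithinAt

theorem circleIntegral_lagrangeInverse_zpow {R : ℝ} (hR₀ : 0 < R) (hR : R < 1 / 8) (b : ℤ) :
    ∮ z in C(0, R), lagrangeInverse φ z ^ b * (z⁻¹ * lagrangeLogDeriv φ z) =
      if b = 0 then 2 * Real.pi * Complex.I else 0 := by
  split_ifs with hb
  · have h := (hφ.differentiableOn_lagrangeLogDeriv.mono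
      (closedBall_subset_ball hR)).circleIntegral_sub_inv_smul (mem_ball_self hR₀)
    simpa [hb, lagrangeLogDeriv] using h
  · refine circleIntegral.integral_eq_zero_of_hasDerivWithinAt hR₀.le
      (f := fun z => lagrangeInverse φ z ^ b / b) fun z hz => ?_
    rw [mem_sphere_zero_iff_norm] at hz
    have hz₁ : ‖z‖ < 1 / 8 := by rwa [hz]
    have hz₀ : z ≠ 0 := ne_zero_of_norm_ne_zero (hz ▸ hR₀.ne')
    have hS := hφ.lagrangeInverse_ne_zero hz₁ hz₀
    refine (((hasDerivAt_zpow b _ (.inl hS)).comp z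
      (hφ.hasDerivAt_lagrangeInverse_of_ne_zero hz₁ hz₀)).div_const
        (b : ℂ)).congr_deriv ?_ |>.hasDerivWithinAt
    have hb' : (b : ℂ) ≠ 0 := by exact_mod_cast hb
    rw [zpow_sub_one₀ hS]
    field_simp

theorem continuousOn_lagrangeInverse_zpow_mul {R : ℝ} (hR₀ : 0 < R) (hR : R < 1 / 8) (b : ℤ) :
    ContinuousOn (fun z => lagrangeInverse φ z ^ b * (z⁻¹ * lagrangeLogDeriv φ z))
      (sphere 0 R) := by
  intro z hz
  rw [mem_sphere_zero_iff_norm] at hz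
  have hz₁ : ‖z‖ < 1 / 8 := by rwa [hz]
  have hz₀ : z ≠ 0 := ne_zero_of_norm_ne_zero (hz ▸ hR₀.ne')
  have hlog := (hφ.differentiableOn_lagrangeLogDeriv.differentiableAt
    (isOpen_ball.mem_nhds (mem_ball_zero_iff.2 hz₁))).continuousAt
  exact (((hφ.continuousAt_lagrangeInverse hz₁).zpow₀ b
    (.inl (hφ.lagrangeInverse_ne_zero hz₁ hz₀))).mul
      ((continuousAt_inv₀ hz₀).mul hlog)).continuousWithinAt

end IsLagrangeKernel

end LagrangeInversion

section Torus

open Metric Set MeasureTheory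
open scoped ContDiff

section Character

variable {ι : Type*} [Fintype ι]

/-- The character `exp (2πi ⟨b, θ⟩)` of the torus `ℝ^ι / ℤ^ι`, as a function on `ℝ^ι`. -/
def character (b : ι → ℤ) (θ : ι → ℝ) : ℂ :=
  Complex.exp (2 * Real.pi * Complex.I * ∑ j, (b j : ℂ) * (θ j : ℂ))

theorem norm_character (b : ι → ℤ) (θ : ι → ℝ) : ‖character b θ‖ = 1 := by
  have h : 2 * (Real.pi : ℂ) * Complex.I * ∑ j, (b j : ℂ) * (θ j : ℂ) =
      ((2 * Real.pi * ∑ j, (b j : ℝ) * θ j : ℝ) : ℂ) * Complex.I := by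
    push_cast
    ring
  rw [character, h, Complex.norm_exp_ofReal_mul_I]

theorem character_sub_mul (a b : ι → ℤ) (θ : ι → ℝ) :
    character (a - b) θ * character b θ = character a θ := by
  simp only [character, ← Complex.exp_add, ← mul_add, ← Finset.sum_add_distrib, ← add_mul]
  simp

theorem character_add_intCast (b d : ι → ℤ) (θ : ι → ℝ) :
    character b (fun j => θ j + d j) = character b θ := by
  refine Complex.exp_eq_exp_iff_exists_int.2 ⟨∑ j, b j * d j, ?_⟩
  push_cast
  simp only [mul_add, Finset.sum_add_distrib]
  ring

theorem contDiff_character (b : ι → ℤ) : ContDiff ℝ ∞ (character b) :=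
  ContDiff.cexp <| contDiff_const.mul <| ContDiff.sum fun j _ => contDiff_const.mul <|
    Complex.ofRealCLM.contDiff.comp (contDiff_apply ℝ ℝ j)

theorem setIntegral_exp_intCast_mul (k : ℤ) :
    ∫ x in Icc (0 : ℝ) 1, Complex.exp (2 * Real.pi * Complex.I * (k * x)) =
      if k = 0 then 1 else 0 := by
  rw [integral_Icc_eq_integral_Ioc, ← intervalIntegral.integral_of_le zero_le_one]
  split_ifs with hk
  · simp [hk]
  · have hc : 2 * (Real.pi : ℂ) * Complex.I * k ≠ 0 :=
      mul_ne_zero Complex.two_pi_I_ne_zero (by exact_mod_cast hk)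
    have hone : Complex.exp (2 * Real.pi * Complex.I * k) = 1 :=
      Complex.exp_eq_one_iff.2 ⟨k, by ring⟩
    simp only [← mul_assoc]
    rw [integral_exp_mul_complex hc]
    simp [hone]

theorem setIntegral_character (b : ι → ℤ) :
    ∫ θ in Icc (0 : ι → ℝ) 1, character b θ = if b = 0 then 1 else 0 := by
  have hprod (θ : ι → ℝ) : character b θ =
      ∏ j, Complex.exp (2 * Real.pi * Complex.I * (b j * θ j)) := by
    rw [character, Finset.mul_sum, Complex.exp_sum]
  rw [← pi_univ_Icc, volume_pi, Measure.restrict_pi_pi]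
  simp only [hprod]
  rw [integral_fintype_prod_eq_prod
    fun j (x : ℝ) => Complex.exp (2 * Real.pi * Complex.I * (b j * x))]
  simp only [Pi.zero_apply, Pi.one_apply, setIntegral_exp_intCast_mul, Finset.prod_ite_zero]
  simp [funext_iff]

end Character

variable {m : ℕ}

/-- The point with coordinates `r₀ s` and `rⱼ exp (2πi θⱼ)` for `j ≥ 1`: the last `m` coordinates
run through a torus with radii `rⱼ`, the first one is free. -/
def torusPoint (r : Fin (m + 1) → ℝ) (s : ℂ) (θ : Fin m → ℝ) : Fin (m + 1) → ℂ :=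
  Fin.cons (r 0 * s) fun j => r j.succ * Complex.exp (2 * Real.pi * Complex.I * θ j)

theorem torusPoint_ne_zero {r : Fin (m + 1) → ℝ} (hr : ∀ i, r i ≠ 0) {s : ℂ} (hs : s ≠ 0)
    (θ : Fin m → ℝ) (i : Fin (m + 1)) : torusPoint r s θ i ≠ 0 := by
  cases i using Fin.cases with
  | zero => exact mul_ne_zero (Complex.ofReal_ne_zero.2 (hr 0)) hs
  | succ j => exact mul_ne_zero (Complex.ofReal_ne_zero.2 (hr _)) (Complex.exp_ne_zero _)

theorem torusPoint_add_intCast (r : Fin (m + 1) → ℝ) (s : ℂ) (θ : Fin m → ℝ) (d : Fin m → ℤ) :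
    torusPoint r s (fun j => θ j + d j) = torusPoint r s θ := by
  have hexp (j) : Complex.exp (2 * Real.pi * Complex.I * ((θ j + d j : ℝ) : ℂ)) =
      Complex.exp (2 * Real.pi * Complex.I * θ j) :=
    Complex.exp_eq_exp_iff_exists_int.2 ⟨d j, by push_cast; ring⟩
  simp only [torusPoint, hexp]

theorem contDiff_torusPoint (r : Fin (m + 1) → ℝ) :
    ContDiff ℝ ∞ fun p : ℂ × (Fin m → ℝ) => torusPoint r p.1 p.2 := by
  refine contDiff_pi.2 fun i => ?_
  cases i using Fin.cases with
  | zero => exact contDiff_const.mul contDiff_fst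
  | succ j => exact contDiff_const.mul <| ContDiff.cexp <| contDiff_const.mul <|
      Complex.ofRealCLM.contDiff.comp ((contDiff_apply ℝ ℝ j).comp contDiff_snd)

theorem monom_torusPoint (r : Fin (m + 1) → ℝ) (a : Fin (m + 1) → ℤ) (s : ℂ) (θ : Fin m → ℝ) :
    monom a (torusPoint r s θ) =
      ((∏ i, r i ^ a i : ℝ) : ℂ) * character (Fin.tail a) θ * s ^ a 0 := by
  have hexp (j : Fin m) : Complex.exp (2 * Real.pi * Complex.I * θ j) ^ a j.succ =
      Complex.exp (2 * Real.pi * Complex.I * (a j.succ * θ j)) := by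
    rw [← Complex.exp_int_mul]
    ring_nf
  rw [monom, Fin.prod_univ_succ, Fin.prod_univ_succ, character, Finset.mul_sum, Complex.exp_sum]
  simp only [torusPoint, Fin.cons_zero, Fin.cons_succ, Fin.tail, mul_zpow, Finset.prod_mul_distrib,
    hexp]
  push_cast
  ring

/-- The sum of the terms of `g` that do not involve the first variable, restricted to the torus with
radii `rⱼ`. -/
def partialConstTerm (r : Fin (m + 1) → ℝ) (g : LaurentPoly ℂ (m + 1)) (θ : Fin m → ℝ) : ℂ :=
  ∑ a ∈ g.coeff.support, if a 0 = 0 then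
    g.coeff a * (((∏ i, r i ^ a i : ℝ) : ℂ) * character (Fin.tail a) θ) else 0

theorem continuous_partialConstTerm (r : Fin (m + 1) → ℝ) (g : LaurentPoly ℂ (m + 1)) :
    Continuous (partialConstTerm r g) := by
  refine continuous_finsetSum _ fun a _ => ?_
  split_ifs
  · exact continuous_const.mul (continuous_const.mul (contDiff_character _).continuous)
  · exact continuous_const

theorem setIntegral_partialConstTerm (r : Fin (m + 1) → ℝ) (g : LaurentPoly ℂ (m + 1)) :
    ∫ θ in Icc (0 : Fin m → ℝ) 1, partialConstTerm r g θ = g.coeff 0 := by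
  have hterm (a : Fin (m + 1) → ℤ) : ∫ θ in Icc (0 : Fin m → ℝ) 1, (if a 0 = 0 then
      g.coeff a * (((∏ i, r i ^ a i : ℝ) : ℂ) * character (Fin.tail a) θ) else 0) =
      if a = 0 then g.coeff 0 else 0 := by
    have ha : a = 0 ↔ a 0 = 0 ∧ Fin.tail a = 0 := by
      rw [funext_iff, Fin.forall_fin_succ, funext_iff]
      rfl
    by_cases h₀ : a 0 = 0
    · simp only [h₀, if_true, ha, true_and, integral_const_mul, setIntegral_character]
      split_ifs with htail
      · simp [ha.2 ⟨h₀, htail⟩]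
      · simp
    · simp [ha, h₀]
  unfold partialConstTerm
  rw [integral_finsetSum]
  · simp only [hterm, Finset.sum_ite_eq', Finsupp.mem_support_iff, ite_not]
    split_ifs with h
    · exact h.symm
    · rfl
  · intro a _
    refine Continuous.integrableOn_Icc ?_
    split_ifs
    · exact continuous_const.mul (continuous_const.mul (contDiff_character _).continuous)
    · exact continuous_const

theorem circleIntegral_eval_torusPoint {φ : ℂ → ℂ} (hφ : IsLagrangeKernel φ) {R : ℝ} (hR₀ : 0 < R)
    (hR : R < 1 / 8) (r : Fin (m + 1) → ℝ) (θ : Fin m → ℝ) (g : LaurentPoly ℂ (m + 1)) :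
    ∮ z in C(0, R), eval g (torusPoint r (lagrangeInverse φ z) θ) *
        (z⁻¹ * lagrangeLogDeriv φ z) =
      2 * Real.pi * Complex.I * partialConstTerm r g θ := by
  have hexpand (z : ℂ) : eval g (torusPoint r (lagrangeInverse φ z) θ) *
      (z⁻¹ * lagrangeLogDeriv φ z) = ∑ a ∈ g.coeff.support,
        g.coeff a * (((∏ i, r i ^ a i : ℝ) : ℂ) * character (Fin.tail a) θ) *
          (lagrangeInverse φ z ^ a 0 * (z⁻¹ * lagrangeLogDeriv φ z)) := by
    rw [eval, Finsupp.sum, Finset.sum_mul]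
    refine Finset.sum_congr rfl fun a _ => ?_
    rw [monom_torusPoint]
    ring
  simp only [hexpand]
  rw [circleIntegral.integral_fun_sum fun a _ => (continuousOn_const.mul
    (hφ.continuousOn_lagrangeInverse_zpow_mul hR₀ hR (a 0))).circleIntegrable hR₀.le,
    partialConstTerm, Finset.mul_sum]
  refine Finset.sum_congr rfl fun a _ => ?_
  rw [circleIntegral.integral_const_mul, hφ.circleIntegral_lagrangeInverse_zpow hR₀ hR]
  split_ifs
  · ring
  · simp

end Torus

section DominantTerm

open Metric Set Filter Topology
open scoped ContDiff Matrix

theorem exists_neg_exponent {n : ℕ} {f : LaurentPoly ℂ n}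
    (hf : (0 : Fin n → ℝ) ∈ interior (newtonPolytope f)) (i : Fin n) :
    ∃ a ∈ f.coeff.support, a i < 0 := by
  by_contra! hnonneg
  have hsub : newtonPolytope f ⊆ {y | 0 ≤ y i} := by
    refine convexHull_min ?_ (convex_halfSpace_ge (LinearMap.proj (R := ℝ) i).isLinear 0)
    rintro _ ⟨a, ha, rfl⟩
    exact Int.cast_nonneg (R := ℝ) (hnonneg a ha)
  have hline : Tendsto (fun ε : ℝ => Pi.single (M := fun _ => ℝ) i (-ε)) (𝓝[>] 0) (𝓝 0) := by
    have h : Continuous fun ε : ℝ => Pi.single (M := fun _ => ℝ) i (-ε) :=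
      (continuous_single i).comp continuous_neg
    simpa using (h.tendsto 0).mono_left nhdsWithin_le_nhds
  obtain ⟨ε, hε, hpos⟩ := ((hline.eventually (mem_interior_iff_mem_nhds.1 hf)).and
    self_mem_nhdsWithin).exists
  have := hsub hε
  simp only [Set.mem_ofPred_eq, Pi.single_eq_same] at this
  linarith [show 0 < ε from hpos]

theorem dotProduct_lt_dotProduct_self {ι R : Type*} [Fintype ι] [CommRing R] [LinearOrder R]
    [IsStrictOrderedRing R] {a v : ι → R} (h : a ⬝ᵥ a ≤ v ⬝ᵥ v) (hne : a ≠ v) :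
    v ⬝ᵥ a < v ⬝ᵥ v := by
  have hpos : 0 < (v - a) ⬝ᵥ (v - a) :=
    (Finset.sum_nonneg fun i _ => mul_self_nonneg _).lt_of_ne' fun h₀ =>
      hne (sub_eq_zero.1 (dotProduct_self_eq_zero.1 h₀)).symm
  have hexpand : (v - a) ⬝ᵥ (v - a) = v ⬝ᵥ v + a ⬝ᵥ a - 2 * v ⬝ᵥ a := by
    simp only [sub_dotProduct, dotProduct_sub, dotProduct_comm a v]
    ring
  linarith

/-- A point `v` of maximal norm in the lowest layer is a vertex, exposed by `v - K eᵢ` for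
large `K`. -/
theorem exists_dotProduct_lt_dotProduct_of_forall_le {ι : Type*} [Fintype ι]
    {s : Finset (ι → ℤ)} (hs : s.Nonempty) (i : ι) :
    ∃ v ∈ s, (∀ a ∈ s, v i ≤ a i) ∧ ∃ u : ι → ℤ, ∀ a ∈ s, a ≠ v → u ⬝ᵥ a < u ⬝ᵥ v := by
  classical
  obtain ⟨b, hb, hmin⟩ := s.exists_min_image (fun a => a i) hs
  obtain ⟨v, hv, hmax⟩ := (s.filter fun a => a i = b i).exists_max_image (fun a => a ⬝ᵥ a)
    ⟨b, by simp [hb]⟩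
  obtain ⟨hvs, hvb⟩ := Finset.mem_filter.1 hv
  have hle (a) (ha : a ∈ s) : v i ≤ a i := hvb.trans_le (hmin a ha)
  have hlarge : ∀ᶠ K : ℤ in atTop, ∀ a ∈ s, a ≠ v →
      (v - Pi.single i K) ⬝ᵥ a < (v - Pi.single i K) ⬝ᵥ v := by
    refine (Filter.eventually_all_finset s).2 fun a ha => ?_
    have hexpand (K : ℤ) (c : ι → ℤ) : (v - Pi.single i K) ⬝ᵥ c = v ⬝ᵥ c - K * c i := by
      rw [sub_dotProduct, single_dotProduct]
    simp only [hexpand]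
    rcases (hle a ha).eq_or_lt with heq | hlt
    · refine .of_forall fun K hne => ?_
      have := dotProduct_lt_dotProduct_self (hmax a (by simp [ha, ← heq, hvb])) hne
      rw [heq]
      linarith
    · filter_upwards [eventually_gt_atTop (v ⬝ᵥ a - v ⬝ᵥ v), eventually_ge_atTop 0] with K h₁ h₂ _
      have := le_mul_of_one_le_right h₂ (Int.sub_pos.2 hlt)
      linarith
  obtain ⟨K, hK⟩ := hlarge.exists
  exact ⟨v, hvs, hle, _, hK⟩

/-- A term `c_v x^v` of `f` which has the least degree in the variable `x₀` among the terms of `f`,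
and which dominates the sum of the others on the torus with radii `r`. Near that torus the equation
`t f = 1` of the fibre is a perturbation of `t c_v x^v = 1`. -/
structure DominantTerm {m : ℕ} (f : LaurentPoly ℂ (m + 1)) where
  /-- the exponent -/
  v : Fin (m + 1) → ℤ
  /-- the pole order in `x₀` -/
  N : ℕ
  /-- the radii of the torus -/
  r : Fin (m + 1) → ℝ
  v_mem : v ∈ f.coeff.support
  v_zero : v 0 = -(N : ℤ)
  N_ne_zero : N ≠ 0
  v_zero_le : ∀ a ∈ f.coeff.support, v 0 ≤ a 0
  r_pos : ∀ i, 0 < r i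
  sum_norm_le : ∑ a ∈ f.coeff.support.erase v, ‖f.coeff a‖ * ∏ i, r i ^ a i ≤
    1 / 2 * (‖f.coeff v‖ * ∏ i, r i ^ v i)

theorem prod_zpow_zpow {ι : Type*} [Fintype ι] {K : Type*} [Field K] {R : K} (hR : R ≠ 0)
    (u a : ι → ℤ) : ∏ i, (R ^ u i) ^ a i = R ^ (u ⬝ᵥ a) := by
  simp_rw [← zpow_mul, dotProduct]
  induction (Finset.univ : Finset ι) using Finset.cons_induction with
  | empty => simp
  | cons i s hi ih => rw [Finset.prod_cons, Finset.sum_cons, zpow_add₀ hR, ih]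

theorem exists_dominantTerm {m : ℕ} {f : LaurentPoly ℂ (m + 1)}
    (hf : ∃ a ∈ f.coeff.support, a 0 < 0) : Nonempty (DominantTerm f) := by
  obtain ⟨a₀, ha₀, hneg⟩ := hf
  obtain ⟨v, hv, hmin, u, hu⟩ := exists_dotProduct_lt_dotProduct_of_forall_le ⟨a₀, ha₀⟩ 0
  have hv₀ : v 0 < 0 := (hmin a₀ ha₀).trans_lt hneg
  have hcv : 0 < ‖f.coeff v‖ := norm_pos_iff.2 (Finsupp.mem_support_iff.1 hv)
  have hlim : Tendsto (fun R : ℝ => ∑ a ∈ f.coeff.support.erase v,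
      ‖f.coeff a‖ * R ^ (u ⬝ᵥ a - u ⬝ᵥ v)) atTop (𝓝 0) := by
    rw [← Finset.sum_const_zero (s := f.coeff.support.erase v)]
    refine tendsto_finsetSum _ fun a ha => ?_
    have h := hu a (Finset.mem_of_mem_erase ha) (Finset.ne_of_mem_erase ha)
    simpa using (tendsto_zpow_atTop_zero (sub_neg.2 h)).const_mul ‖f.coeff a‖
  obtain ⟨R, hle, hR⟩ := ((hlim.eventually_le_const (half_pos hcv)).and
    (eventually_gt_atTop 0)).exists
  refine ⟨⟨v, (-v 0).toNat, fun i => R ^ u i, hv, by omega, by omega, hmin,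
    fun i => zpow_pos hR _, ?_⟩⟩
  simp only [prod_zpow_zpow hR.ne']
  calc ∑ a ∈ f.coeff.support.erase v, ‖f.coeff a‖ * R ^ (u ⬝ᵥ a)
      = (∑ a ∈ f.coeff.support.erase v, ‖f.coeff a‖ * R ^ (u ⬝ᵥ a - u ⬝ᵥ v)) * R ^ (u ⬝ᵥ v) := by
        simp_rw [Finset.sum_mul, mul_assoc, ← zpow_add₀ hR.ne', sub_add_cancel]
    _ ≤ ‖f.coeff v‖ / 2 * R ^ (u ⬝ᵥ v) := by gcongr
    _ = 1 / 2 * (‖f.coeff v‖ * R ^ (u ⬝ᵥ v)) := by ring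

namespace DominantTerm

variable {m : ℕ} {f : LaurentPoly ℂ (m + 1)} (T : DominantTerm f)

/-- The coefficients of the restriction of `f` to the torus with radii `r`, as a trigonometric
polynomial. -/
def scaledCoeff (a : Fin (m + 1) → ℤ) : ℂ := f.coeff a * ((∏ i, T.r i ^ a i : ℝ) : ℂ)

theorem norm_scaledCoeff (a : Fin (m + 1) → ℤ) :
    ‖T.scaledCoeff a‖ = ‖f.coeff a‖ * ∏ i, T.r i ^ a i := by
  have hprod : 0 ≤ ∏ i, T.r i ^ a i := Finset.prod_nonneg fun i _ => (zpow_pos (T.r_pos i) _).le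
  rw [scaledCoeff, norm_mul, Complex.norm_real, Real.norm_of_nonneg hprod]

theorem scaledCoeff_v_ne_zero : T.scaledCoeff T.v ≠ 0 :=
  mul_ne_zero (Finsupp.mem_support_iff.1 T.v_mem) (Complex.ofReal_ne_zero.2
    (Finset.prod_ne_zero_iff.2 fun i _ => (zpow_pos (T.r_pos i) _).ne'))

/-- The sum of all terms of `f` other than the dominant one, divided by the dominant one, at the
points of coordinates `r₀ s` and `rⱼ exp (2πi θⱼ)`. -/
def perturb (θ : Fin m → ℝ) (s : ℂ) : ℂ :=
  ∑ a ∈ f.coeff.support.erase T.v, T.scaledCoeff a / T.scaledCoeff T.v *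
    (character (Fin.tail (a - T.v)) θ * s ^ (a 0 - T.v 0).toNat)

theorem eval_torusPoint {s : ℂ} (hs : s ≠ 0) (θ : Fin m → ℝ) :
    eval f (torusPoint T.r s θ) =
      T.scaledCoeff T.v * character (Fin.tail T.v) θ * (1 + T.perturb θ s) / s ^ T.N := by
  have hterm (a) : f.coeff a * monom a (torusPoint T.r s θ) =
      T.scaledCoeff a * character (Fin.tail a) θ * s ^ a 0 := by
    rw [monom_torusPoint, scaledCoeff]
    ring
  rw [eval, Finsupp.sum]
  simp only [hterm]
  rw [← Finset.add_sum_erase _ _ T.v_mem, perturb, mul_add, add_div, Finset.mul_sum,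
    Finset.sum_div]
  congr 1
  · rw [T.v_zero, zpow_neg, zpow_natCast]
    ring
  · refine Finset.sum_congr rfl fun a ha => ?_
    have hle := T.v_zero_le a (Finset.mem_of_mem_erase ha)
    have hpow : s ^ a 0 = s ^ (a 0 - T.v 0).toNat / s ^ T.N := by
      rw [← zpow_natCast, ← zpow_natCast, ← zpow_sub₀ hs, Int.toNat_of_nonneg (by omega),
        T.v_zero]
      congr 1
      ring
    have hchar : character (Fin.tail a) θ =
        character (Fin.tail (a - T.v)) θ * character (Fin.tail T.v) θ :=
      (character_sub_mul (Fin.tail a) (Fin.tail T.v) θ).symm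
    have := T.scaledCoeff_v_ne_zero
    rw [hpow, hchar]
    field_simp

theorem norm_perturb_le (θ : Fin m → ℝ) {s : ℂ} (hs : ‖s‖ ≤ 1) : ‖T.perturb θ s‖ ≤ 1 / 2 := by
  have hv : 0 < ‖T.scaledCoeff T.v‖ := norm_pos_iff.2 T.scaledCoeff_v_ne_zero
  have hsum := T.sum_norm_le
  simp only [← norm_scaledCoeff] at hsum
  refine (norm_sum_le _ _).trans (le_trans (Finset.sum_le_sum fun a _ => ?_)
    ((Finset.sum_div _ _ _).symm.trans_le ((div_le_iff₀ hv).2 hsum)))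
  rw [norm_mul, norm_mul, norm_character, norm_pow, norm_div, one_mul]
  exact mul_le_of_le_one_right (by positivity) (pow_le_one₀ (norm_nonneg s) hs)

theorem one_add_perturb_mem_slitPlane (θ : Fin m → ℝ) {s : ℂ} (hs : s ∈ ball (0 : ℂ) 1) :
    1 + T.perturb θ s ∈ Complex.slitPlane :=
  Complex.mem_slitPlane_of_norm_lt_one
    ((T.norm_perturb_le θ (mem_ball_zero_iff.1 hs).le).trans_lt (by norm_num))

theorem contDiff_perturb : ContDiff ℝ ∞ (Function.uncurry T.perturb) :=
  ContDiff.sum fun _ _ => contDiff_const.mul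
    (((contDiff_character _).comp contDiff_fst).mul (contDiff_snd.pow _))

/-- The branch of `(1 + perturb)^(1/N)` close to `1`. In terms of it the equation `t f = 1` reads
`(s / kernel)^N = t c_v x^v s^N`, whose right-hand side is independent of `s`. -/
def kernel (θ : Fin m → ℝ) (s : ℂ) : ℂ := Complex.exp (Complex.log (1 + T.perturb θ s) / T.N)

theorem natCast_N_ne_zero : (T.N : ℂ) ≠ 0 := Nat.cast_ne_zero.2 T.N_ne_zero

theorem kernel_pow (θ : Fin m → ℝ) {s : ℂ} (hs : s ∈ ball (0 : ℂ) 1) :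
    T.kernel θ s ^ T.N = 1 + T.perturb θ s := by
  rw [kernel, ← Complex.exp_nat_mul, mul_div_cancel₀ _ T.natCast_N_ne_zero,
    Complex.exp_log (Complex.slitPlane_ne_zero (T.one_add_perturb_mem_slitPlane θ hs))]

theorem contDiffOn_kernel : ContDiffOn ℝ ∞ (Function.uncurry T.kernel) (univ ×ˢ ball 0 1) := by
  rintro ⟨θ, s⟩ ⟨-, hs⟩
  have hlog : ContDiffAt ℝ ∞ Complex.log (1 + T.perturb θ s) :=
    (Complex.contDiffAt_log (T.one_add_perturb_mem_slitPlane θ hs)).restrict_scalars ℝ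
  exact ((hlog.comp (θ, s) (contDiff_const.add T.contDiff_perturb).contDiffAt).div_const
    _).cexp.contDiffWithinAt

theorem isLagrangeKernel (θ : Fin m → ℝ) : IsLagrangeKernel (T.kernel θ) where
  differentiableOn s hs := by
    have hperturb : DifferentiableAt ℂ (T.perturb θ) s := by
      unfold perturb
      fun_prop
    exact (((hperturb.const_add 1).clog
      (T.one_add_perturb_mem_slitPlane θ hs)).div_const _).cexp.differentiableWithinAt
  ne_zero _ _ := Complex.exp_ne_zero _
  norm_le s hs := by
    have hpow : ‖T.kernel θ s‖ ^ T.N ≤ 2 := by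
      rw [← norm_pow, T.kernel_pow θ hs]
      refine (norm_add_le _ _).trans ?_
      rw [norm_one]
      linarith [T.norm_perturb_le θ (mem_ball_zero_iff.1 hs).le]
    exact le_of_pow_le_pow_left₀ T.N_ne_zero two_pos.le
      (hpow.trans (le_self_pow₀ one_le_two T.N_ne_zero))

theorem kernel_add_intCast (θ : Fin m → ℝ) (d : Fin m → ℤ) :
    T.kernel (fun j => θ j + d j) = T.kernel θ := by
  simp only [funext_iff, kernel, perturb, character_add_intCast, implies_true]

/-- The point over `θ` whose first coordinate is `r₀ s`, where `s = w * kernel θ s`. -/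
def solutionPoint (w : ℂ) (θ : Fin m → ℝ) : Fin (m + 1) → ℂ :=
  torusPoint T.r (lagrangeInverse (T.kernel θ) w) θ

theorem solutionPoint_ne_zero {w : ℂ} (hw : ‖w‖ < 1 / 8) (hw₀ : w ≠ 0) (θ : Fin m → ℝ)
    (i : Fin (m + 1)) : T.solutionPoint w θ i ≠ 0 :=
  torusPoint_ne_zero (fun i => (T.r_pos i).ne')
    ((T.isLagrangeKernel θ).lagrangeInverse_ne_zero hw hw₀) θ i

theorem solutionPoint_add_intCast (w : ℂ) (θ : Fin m → ℝ) (d : Fin m → ℤ) :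
    T.solutionPoint w (fun j => θ j + d j) = T.solutionPoint w θ := by
  rw [solutionPoint, kernel_add_intCast, torusPoint_add_intCast, solutionPoint]

theorem eval_solutionPoint {w : ℂ} (hw : ‖w‖ < 1 / 8) (hw₀ : w ≠ 0) (θ : Fin m → ℝ) :
    eval f (T.solutionPoint w θ) =
      T.scaledCoeff T.v * character (Fin.tail T.v) θ / w ^ T.N := by
  have hφ := T.isLagrangeKernel θ
  have hs := mem_ball_one_of_mem_ball_half (hφ.lagrangeInverse_mem_ball hw)
  have hpow : lagrangeInverse (T.kernel θ) w ^ T.N =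
      w ^ T.N * (1 + T.perturb θ (lagrangeInverse (T.kernel θ) w)) := by
    conv_lhs => rw [hφ.lagrangeInverse_eq_mul hw]
    rw [mul_pow, T.kernel_pow θ hs]
  rw [solutionPoint, T.eval_torusPoint (hφ.lagrangeInverse_ne_zero hw hw₀), hpow,
    mul_div_mul_right _ _ (Complex.slitPlane_ne_zero (T.one_add_perturb_mem_slitPlane θ hs))]

theorem contDiffAt_solutionPoint {w : ℂ} (hw : ‖w‖ < 1 / 8) (θ : Fin m → ℝ) :
    ContDiffAt ℝ ∞ (fun p : ℂ × (Fin m → ℝ) => T.solutionPoint p.1 p.2) (w, θ) :=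
  have hroot : ContDiffAt ℝ ∞ (fun p : ℂ × (Fin m → ℝ) => lagrangeInverse (T.kernel p.2) p.1)
      (w, θ) :=
    ContDiffAt.comp (f := Prod.swap) (w, θ)
      (contDiffAt_lagrangeInverse T.contDiffOn_kernel T.isLagrangeKernel θ hw)
      (contDiff_snd.prodMk contDiff_fst).contDiffAt
  (contDiff_torusPoint T.r).contDiffAt.comp (w, θ) (hroot.prodMk contDiffAt_snd)

end DominantTerm

end DominantTerm

section Cycle

open Metric Set
open scoped ContDiff

theorem sum_range_add_of_periodic {M : Type*} [AddCommGroup M] {g : ℤ → M} {N : ℕ}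
    (hg : Function.Periodic g N) (c : ℤ) :
    ∑ k ∈ Finset.range N, g (k + c) = ∑ k ∈ Finset.range N, g k := by
  have hsucc (c : ℤ) :
      ∑ k ∈ Finset.range N, g (k + (c + 1)) = ∑ k ∈ Finset.range N, g (k + c) := by
    have h : ∑ k ∈ Finset.range N, g (k + c) + g (N + c) =
        ∑ k ∈ Finset.range N, g ((k + 1 : ℕ) + c) + g ((0 : ℕ) + c) := by
      rw [← Finset.sum_range_succ (fun k : ℕ => g (k + c)),
        ← Finset.sum_range_succ' (fun k : ℕ => g (k + c))]
    rw [add_comm (N : ℤ) c, hg c, Nat.cast_zero, zero_add, add_left_inj] at h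
    rw [h]
    exact Finset.sum_congr rfl fun k _ => congrArg g (by push_cast; ring)
  induction c using Int.induction_on with
  | zero => simp only [add_zero]
  | succ i ih => rw [hsucc, ih]
  | pred i ih => rw [← ih, ← hsucc, sub_add_cancel]

theorem boundary_sum_single {X : Type} {ι : Type*} {k : ℕ} (s : Finset ι)
    (σ : ι → SCube X (k + 1)) :
    SChain.boundary (∑ j ∈ s, Finsupp.single (σ j) 1) =
      ∑ i : Fin (k + 1), (-1 : ℤ) ^ (i : ℕ) •
        (∑ j ∈ s, Finsupp.single ((σ j).face i 1) 1 -
          ∑ j ∈ s, Finsupp.single ((σ j).face i 0) 1) := by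
  rw [SChain.boundary, ← Finsupp.sum_finsetSum_index (by simp) (fun _ _ _ => add_smul _ _ _)]
  simp only [Finsupp.sum_single_index, zero_smul, one_smul]
  rw [Finset.sum_comm]
  simp only [← Finset.smul_sum, Finset.sum_sub_distrib]

theorem isCycle_sum_single_of_face_eq {X : Type} {k N : ℕ} {σ : ℤ → SCube X (k + 1)}
    (hσ : Function.Periodic σ N) (d : Fin (k + 1) → ℤ)
    (hface : ∀ i j, (σ j).face i 1 = (σ (j + d i)).face i 0) :
    SChain.IsCycle (∑ j ∈ Finset.range N, Finsupp.single (σ j) 1) := by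
  have hcancel (i : Fin (k + 1)) :
      ∑ j ∈ Finset.range N, Finsupp.single ((σ j).face i 1) (1 : ℤ) =
        ∑ j ∈ Finset.range N, Finsupp.single ((σ j).face i 0) 1 := by
    simp only [hface]
    exact sum_range_add_of_periodic (g := fun j => Finsupp.single ((σ j).face i 0) 1)
      (hσ.comp fun τ => Finsupp.single (τ.face i 0) 1) (d i)
  rw [SChain.IsCycle, boundary_sum_single]
  simp only [hcancel, sub_self, smul_zero, Finset.sum_const_zero, zero_mem]

theorem integralChain_sum_single {n k : ℕ} {ι : Type*} (s : Finset ι) (η : Form n k)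
    (σ : ι → SCube (Fin n → ℂ) k) :
    integralChain η (∑ j ∈ s, Finsupp.single (σ j) 1) = ∑ j ∈ s, integralCube η (σ j) := by
  rw [integralChain, ← Finsupp.sum_finsetSum_index (by simp) (fun _ _ _ => by push_cast; ring)]
  simp

theorem coe_clampCube {k : ℕ} {θ : Fin k → ℝ} (hθ : θ ∈ Icc (0 : Fin k → ℝ) 1) :
    (fun j => (clampCube θ j : ℝ)) = θ :=
  funext fun j => congrArg Subtype.val (projIcc_of_mem zero_le_one ⟨hθ.1 j, hθ.2 j⟩)

namespace DominantTerm

variable {m : ℕ} {f : LaurentPoly ℂ (m + 1)} (T : DominantTerm f)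

/-- The branches of the `N`-th root of `κ ^ N * character (Fin.tail v)`, indexed modulo `N`. -/
def branch (κ : ℂ) (k : ℤ) (θ : Fin m → ℝ) : ℂ :=
  κ * Complex.exp (2 * Real.pi * Complex.I * ((k + ∑ j, (Fin.tail T.v j : ℂ) * θ j) / T.N))

theorem norm_branch (κ : ℂ) (k : ℤ) (θ : Fin m → ℝ) : ‖T.branch κ k θ‖ = ‖κ‖ := by
  have h : 2 * (Real.pi : ℂ) * Complex.I * ((k + ∑ j, (Fin.tail T.v j : ℂ) * θ j) / T.N) =
      ((2 * Real.pi * ((k + ∑ j, (Fin.tail T.v j : ℝ) * θ j) / T.N) : ℝ) : ℂ) * Complex.I := by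
    push_cast
    ring
  rw [branch, norm_mul, h, Complex.norm_exp_ofReal_mul_I, mul_one]

theorem branch_pow (κ : ℂ) (k : ℤ) (θ : Fin m → ℝ) :
    T.branch κ k θ ^ T.N = κ ^ T.N * character (Fin.tail T.v) θ := by
  rw [branch, mul_pow, ← Complex.exp_nat_mul, character]
  congr 1
  refine Complex.exp_eq_exp_iff_exists_int.2 ⟨k, ?_⟩
  have := T.natCast_N_ne_zero
  field_simp
  ring

theorem branch_periodic (κ : ℂ) : Function.Periodic (T.branch κ) T.N := by
  refine fun k => funext fun θ => congrArg (κ * ·) (Complex.exp_eq_exp_iff_exists_int.2 ⟨1, ?_⟩)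
  have := T.natCast_N_ne_zero
  push_cast
  field_simp
  ring

theorem branch_add_intCast (κ : ℂ) (k : ℤ) (θ : Fin m → ℝ) (d : Fin m → ℤ) :
    T.branch κ k (fun j => θ j + d j) = T.branch κ (k + ∑ j, Fin.tail T.v j * d j) θ := by
  rw [branch, branch]
  congr 4
  push_cast
  simp only [mul_add, Finset.sum_add_distrib]
  ring

theorem contDiff_branch (k : ℤ) :
    ContDiff ℝ ∞ fun p : ℂ × (Fin m → ℝ) => T.branch p.1 k p.2 :=
  contDiff_fst.mul <| ContDiff.cexp <| contDiff_const.mul <| ContDiff.div_const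
    (contDiff_const.add <| ContDiff.sum fun j _ => contDiff_const.mul <|
      Complex.ofRealCLM.contDiff.comp ((contDiff_apply ℝ ℝ j).comp contDiff_snd)) _

/-- `κ` is a choice of the `N`-th root of `t c_v r^v`, in the range of the Lagrange inversion. -/
structure IsRootAt (κ t : ℂ) : Prop where
  norm_lt : ‖κ‖ < 1 / 8
  ne_zero : κ ≠ 0
  pow_eq : κ ^ T.N = t * T.scaledCoeff T.v

namespace IsRootAt

variable {T} {κ t : ℂ} (hκ : T.IsRootAt κ t) (k : ℤ) (θ : Fin m → ℝ)
include hκ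

theorem norm_branch_lt : ‖T.branch κ k θ‖ < 1 / 8 := by
  rw [norm_branch]
  exact hκ.norm_lt

theorem branch_ne_zero : T.branch κ k θ ≠ 0 := mul_ne_zero hκ.ne_zero (Complex.exp_ne_zero _)

theorem mul_scaledCoeff_mul_character_eq :
    t * (T.scaledCoeff T.v * character (Fin.tail T.v) θ) = T.branch κ k θ ^ T.N := by
  rw [T.branch_pow, hκ.pow_eq, mul_assoc]

end IsRootAt

/-- The `k`-th of the `N` points of the fibre over the point `θ` of the torus. -/
def cyclePoint (κ : ℂ) (k : ℤ) (θ : Fin m → ℝ) : Fin (m + 1) → ℂ :=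
  T.solutionPoint (T.branch κ k θ) θ

theorem IsRootAt.cyclePoint_mem_fiber {T : DominantTerm f} {κ t : ℂ} (hκ : T.IsRootAt κ t) (k : ℤ)
    (θ : Fin m → ℝ) : T.cyclePoint κ k θ ∈ fiber f t := by
  have hw := hκ.norm_branch_lt k θ
  have hw₀ := hκ.branch_ne_zero k θ
  refine ⟨T.solutionPoint_ne_zero hw hw₀ θ, ?_⟩
  rw [pencilFun, cyclePoint, T.eval_solutionPoint hw hw₀, ← mul_div_assoc,
    hκ.mul_scaledCoeff_mul_character_eq k, div_self (pow_ne_zero _ hw₀), sub_self]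

theorem cyclePoint_add_intCast (κ : ℂ) (k : ℤ) (θ : Fin m → ℝ) (d : Fin m → ℤ) :
    T.cyclePoint κ k (fun j => θ j + d j) =
      T.cyclePoint κ (k + ∑ j, Fin.tail T.v j * d j) θ := by
  rw [cyclePoint, branch_add_intCast, solutionPoint_add_intCast, cyclePoint]

theorem contDiffAt_cyclePoint (k : ℤ) {κ : ℂ} (hκ : ‖κ‖ < 1 / 8) (θ : Fin m → ℝ) :
    ContDiffAt ℝ ∞ (fun p : ℂ × (Fin m → ℝ) => T.cyclePoint p.1 k p.2) (κ, θ) :=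
  ContDiffAt.comp (f := fun p : ℂ × (Fin m → ℝ) => (T.branch p.1 k p.2, p.2)) (κ, θ)
    (T.contDiffAt_solutionPoint (by rwa [T.norm_branch]) θ)
    ((T.contDiff_branch k).prodMk contDiff_snd).contDiffAt

/-- The cube traced by the `k`-th point of the fibre over the torus. -/
def cycleCube (κ : ℂ) (k : ℤ) : SCube (Fin (m + 1) → ℂ) m :=
  fun θ => T.cyclePoint κ k fun j => θ j

theorem cycleCube_clampCube (κ : ℂ) (k : ℤ) {θ : Fin m → ℝ} (hθ : θ ∈ Icc (0 : Fin m → ℝ) 1) :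
    T.cycleCube κ k (clampCube θ) = T.cyclePoint κ k θ :=
  congrArg (T.cyclePoint κ k) (coe_clampCube hθ)

theorem face_cycleCube {m : ℕ} {f : LaurentPoly ℂ (m + 1 + 1)} (T : DominantTerm f) (κ : ℂ)
    (i : Fin (m + 1)) (k : ℤ) :
    (T.cycleCube κ k).face i 1 = (T.cycleCube κ (k + Fin.tail T.v i)).face i 0 := by
  ext1 θ
  have hshift : (fun j => (i.insertNth (α := fun _ => unitInterval) 1 θ j : ℝ)) =
      fun j => (i.insertNth (α := fun _ => unitInterval) 0 θ j : ℝ) +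
        ((Pi.single i 1 : Fin (m + 1) → ℤ) j : ℝ) := by
    funext j
    cases j using Fin.succAboveCases i <;> simp
  have hsum : ∑ j, Fin.tail T.v j * (Pi.single i 1 : Fin (m + 1) → ℤ) j = Fin.tail T.v i := by
    simp [Pi.single_apply]
  simp only [SCube.face, cycleCube]
  rw [hshift, cyclePoint_add_intCast, hsum]

theorem isCycle_sum_cycleCube (κ : ℂ) :
    SChain.IsCycle (∑ k ∈ Finset.range T.N, Finsupp.single (T.cycleCube κ k) 1) := by
  cases m with
  | zero => trivial
  | succ m =>
    refine isCycle_sum_single_of_face_eq (fun k => ?_) (Fin.tail T.v) (T.face_cycleCube κ)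
    funext θ
    rw [cycleCube, cyclePoint, T.branch_periodic κ k, cycleCube, cyclePoint]

/-- The cycles over a set of parameters on which a smooth `N`-th root `κ` of `t c_v r^v` exists. -/
def cycleFamily {D : Set ℂ} {κ : ℂ → ℂ} (hsmooth : ContDiffOn ℝ ∞ κ D)
    (hκ : ∀ t ∈ D, T.IsRootAt (κ t) t) : CycleFamily f D where
  size := T.N
  coef _ := 1
  cube k t := T.cycleCube (κ t) k
  smooth k := by
    have hcomp : ContDiffOn ℝ ∞ (fun p : ℂ × (Fin m → ℝ) => T.cyclePoint (κ p.1) k p.2)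
        (D ×ˢ Icc 0 1) := fun p hp =>
      ContDiffAt.comp_contDiffWithinAt (f := fun p : ℂ × (Fin m → ℝ) => (κ p.1, p.2)) p
        (T.contDiffAt_cyclePoint k (hκ p.1 hp.1).norm_lt p.2)
        (((hsmooth p.1 hp.1).comp p contDiff_fst.contDiffWithinAt fun _ hq => hq.1).prodMk
          contDiff_snd.contDiffWithinAt)
    exact hcomp.congr fun p hp => T.cycleCube_clampCube _ _ hp.2
  mem_fiber k t ht _ := (hκ t ht).cyclePoint_mem_fiber k _
  isCycle t _ := by
    rw [← Finset.sum_range fun k => Finsupp.single (T.cycleCube (κ t) k) (1 : ℤ)]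
    exact T.isCycle_sum_cycleCube (κ t)

theorem period_cycleFamily (η : RelativeForm m) {D : Set ℂ} {κ : ℂ → ℂ}
    (hsmooth : ContDiffOn ℝ ∞ κ D) (hκ : ∀ t ∈ D, T.IsRootAt (κ t) t) (t : ℂ) :
    period η (T.cycleFamily hsmooth hκ) t =
      ∑ k ∈ Finset.range T.N, integralCube (η.at t) (T.cycleCube (κ t) k) := by
  rw [Finset.sum_range]
  exact integralChain_sum_single Finset.univ (η.at t) fun k : Fin T.N => T.cycleCube (κ t) k

end DominantTerm

end Cycle

section Residue

open Metric Set Filter Topology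

theorem dlogVol_cons {m : ℕ} {x : Fin (m + 1) → ℂ} (hx : ∀ i, x i ≠ 0)
    {V : Fin m → Fin (m + 1) → ℂ} {c : ℂ}
    (hV : ∀ i j, V j i.succ = if i = j then c * x i.succ else 0) :
    dlogVol (m + 1) x (Fin.cons (Pi.single 0 1) V) = (x 0)⁻¹ * c ^ m := by
  let M : Matrix (Fin (m + 1)) (Fin (m + 1)) ℂ := fun j k =>
    (x k)⁻¹ * (Fin.cons (Pi.single 0 1) V : Fin (m + 1) → Fin (m + 1) → ℂ) j k
  have hM : M.IsLowerTriangular := by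
    intro i j hij
    rw [OrderDual.toDual_lt_toDual] at hij
    refine mul_eq_zero_of_right _ ?_
    cases j using Fin.cases with
    | zero => exact absurd hij (Fin.not_lt_zero i)
    | succ j =>
      cases i using Fin.cases with
      | zero => simp
      | succ i => simp [hV, (Fin.succ_lt_succ_iff.1 hij).ne']
  change M.det = _
  rw [Matrix.det_of_isLowerTriangular M hM, Fin.prod_univ_succ]
  simp [M, hV, hx, mul_comm]

theorem wedgeCovector_cons {n k : ℕ} {α : (Fin n → ℂ) →ₗ[ℂ] ℂ}
    (η : (Fin n → ℂ) [⋀^Fin k]→ₗ[ℂ] ℂ) (e : Fin n → ℂ) {V : Fin k → Fin n → ℂ}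
    (hV : ∀ j, α (V j) = 0) : wedgeCovector α η (Fin.cons e V) = α e * η V := by
  rw [wedgeCovector, AlternatingMap.alternatizeUncurryFin_apply, Fin.sum_univ_succ]
  simp [hV, Fin.removeNth_zero]

theorem differentiableAt_pencilFun {n : ℕ} {x : Fin n → ℂ} (hx : ∀ i, x i ≠ 0)
    (f : LaurentPoly ℂ n) (t : ℂ) : DifferentiableAt ℂ (pencilFun f t) x :=
  ((hasFDerivAt_eval hx f).differentiableAt.const_mul t).const_sub 1

theorem fderiv_pencilFun_eq_zero {n : ℕ} {f : LaurentPoly ℂ n} {t : ℂ} {E : Type*}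
    [NormedAddCommGroup E] [NormedSpace ℝ E] {γ : E → Fin n → ℂ} {θ : E} {γ' : E →L[ℝ] Fin n → ℂ}
    (hγ : HasFDerivAt γ γ' θ) (hmem : ∀ θ, γ θ ∈ fiber f t) (v : E) :
    fderiv ℂ (pencilFun f t) (γ θ) (γ' v) = 0 := by
  have hcomp : HasFDerivAt (pencilFun f t ∘ γ)
      (((fderiv ℂ (pencilFun f t) (γ θ)).restrictScalars ℝ).comp γ') θ :=
    ((differentiableAt_pencilFun (hmem θ).1 f t).hasFDerivAt.restrictScalars ℝ).comp θ hγ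
  have hzero : pencilFun f t ∘ γ = fun _ => 0 := funext fun θ => (hmem θ).2
  rw [hzero] at hcomp
  exact DFunLike.congr_fun (hcomp.unique (hasFDerivAt_const _ _)) v

theorem IsResidueAt.fderiv_mul_apply {m : ℕ} {f : LaurentPoly ℂ (m + 1)} {ω : RelativeForm m}
    {t : ℂ} (hω : IsResidueAt f ω t) {x : Fin (m + 1) → ℂ} (hx : x ∈ fiber f t)
    {V : Fin m → Fin (m + 1) → ℂ} (hker : ∀ j, fderiv ℂ (pencilFun f t) x (V j) = 0)
    (hV : ∀ i j, V j i.succ = if i = j then 2 * Real.pi * Complex.I * x i.succ else 0) :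
    fderiv ℂ (pencilFun f t) x (Pi.single 0 1) * x 0 * ω.at t x V = 1 := by
  have hres := DFunLike.congr_fun (hω x hx) (Fin.cons (Pi.single 0 1) V)
  rw [wedgeCovector_cons _ _ hker, AlternatingMap.smul_apply, dlogVol_cons hx.1 hV, smul_eq_mul,
    mul_left_comm, inv_mul_cancel₀ (pow_ne_zero m Complex.two_pi_I_ne_zero), mul_one] at hres
  rw [ContinuousLinearMap.coe_coe] at hres
  rw [mul_right_comm, hres, inv_mul_cancel₀ (hx.1 0)]

theorem hasDerivAt_torusPoint {m : ℕ} (r : Fin (m + 1) → ℝ) (θ : Fin m → ℝ) (s : ℂ) :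
    HasDerivAt (fun s => torusPoint r s θ) (Pi.single 0 (r 0 : ℂ)) s := by
  refine hasDerivAt_pi.2 fun i => ?_
  cases i using Fin.cases with
  | zero => simpa [torusPoint] using (hasDerivAt_id s).const_mul (r 0 : ℂ)
  | succ j => simpa [torusPoint] using hasDerivAt_const s _

theorem hasFDerivAt_torusPoint_apply_succ {m : ℕ} {r : Fin (m + 1) → ℝ} {S : (Fin m → ℝ) → ℂ}
    {θ : Fin m → ℝ} {L : (Fin m → ℝ) →L[ℝ] Fin (m + 1) → ℂ}
    (hL : HasFDerivAt (fun θ => torusPoint r (S θ) θ) L θ) (i j : Fin m) :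
    L (Pi.single j 1) i.succ =
      if i = j then 2 * Real.pi * Complex.I * torusPoint r (S θ) θ i.succ else 0 := by
  have hcoord : HasFDerivAt (fun θ : Fin m → ℝ => (θ i : ℂ))
      (Complex.ofRealCLM.comp (ContinuousLinearMap.proj i)) θ :=
    (Complex.ofRealCLM.comp
      (ContinuousLinearMap.proj (R := ℝ) (φ := fun _ : Fin m => ℝ) i)).hasFDerivAt
  have h := (hasFDerivAt_pi'.1 hL i.succ).unique (((hcoord.const_mul _).cexp).const_mul _)
  have hj := DFunLike.congr_fun h (Pi.single j 1)
  simp only [ContinuousLinearMap.comp_apply, ContinuousLinearMap.proj_apply] at hj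
  rw [hj]
  by_cases hij : i = j
  · subst hij
    simp only [smul_apply, ContinuousLinearMap.comp_apply,
      ContinuousLinearMap.proj_apply, Pi.single_eq_same, Complex.ofRealCLM_apply,
      Complex.ofReal_one, smul_eq_mul, mul_one, if_true, torusPoint, Fin.cons_succ]
    ring
  · simp [hij]

namespace DominantTerm

variable {m : ℕ} {f : LaurentPoly ℂ (m + 1)} (T : DominantTerm f)

theorem hasDerivAt_solutionPoint {w : ℂ} (hw : ‖w‖ < 1 / 8) (hw₀ : w ≠ 0) (θ : Fin m → ℝ) :
    HasDerivAt (fun w => T.solutionPoint w θ)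
      ((T.solutionPoint w θ 0 * (w⁻¹ * lagrangeLogDeriv (T.kernel θ) w)) • Pi.single 0 1) w := by
  refine ((hasDerivAt_torusPoint T.r θ _).scomp w
    ((T.isLagrangeKernel θ).hasDerivAt_lagrangeInverse_of_ne_zero hw hw₀)).congr_deriv ?_
  rw [← Pi.single_smul, ← Pi.single_smul]
  congr 1
  simp only [solutionPoint, torusPoint, Fin.cons_zero, smul_eq_mul]
  ring

/-- On the curve `w ↦ solutionPoint w θ` the function `t f` is `(w₀ / w)^N`, where `w₀` is the
parameter of the point of the fibre. -/
theorem fderiv_pencilFun_mul {t w : ℂ} {θ : Fin m → ℝ} (hw : ‖w‖ < 1 / 8) (hw₀ : w ≠ 0)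
    (ht : t * (T.scaledCoeff T.v * character (Fin.tail T.v) θ) = w ^ T.N) :
    fderiv ℂ (pencilFun f t) (T.solutionPoint w θ) (Pi.single 0 1) * T.solutionPoint w θ 0 *
      lagrangeLogDeriv (T.kernel θ) w = T.N := by
  have hchain := ((differentiableAt_pencilFun (T.solutionPoint_ne_zero hw hw₀ θ) f
    t).hasFDerivAt.comp_hasDerivAt w (T.hasDerivAt_solutionPoint hw hw₀ θ))
  have hcurve : (pencilFun f t ∘ fun w => T.solutionPoint w θ) =ᶠ[𝓝 w]
      fun z => 1 - w ^ T.N * z ^ (-(T.N : ℤ)) := by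
    filter_upwards [continuous_norm.continuousAt.eventually_lt_const hw,
      isOpen_ne.mem_nhds hw₀] with z hz hz₀
    rw [Function.comp_apply, pencilFun, T.eval_solutionPoint hz hz₀, ← mul_div_assoc, ht,
      zpow_neg, zpow_natCast, div_eq_mul_inv]
  have hpow := (((hasDerivAt_zpow (-(T.N : ℤ)) w (.inl hw₀)).const_mul (w ^ T.N)).const_sub
    1).congr_of_eventuallyEq hcurve
  have h := hchain.unique hpow
  rw [map_smul, smul_eq_mul, zpow_sub_one₀ hw₀, zpow_neg, zpow_natCast] at h
  field_simp at h
  push_cast at h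
  linear_combination h

variable {T}

theorem IsRootAt.residue_pullback {ω : RelativeForm m} {κ t : ℂ} (hκ : T.IsRootAt κ t)
    (hω : IsResidueAt f ω t) (k : ℤ) {θ : Fin m → ℝ} (hθ : θ ∈ Icc (0 : Fin m → ℝ) 1) :
    (ω.at t (T.cycleCube κ k (clampCube θ)) fun j =>
      fderivWithin ℝ (fun θ' => T.cycleCube κ k (clampCube θ')) (Icc 0 1) θ (Pi.single j 1)) =
      (T.N : ℂ)⁻¹ * lagrangeLogDeriv (T.kernel θ) (T.branch κ k θ) := by
  have hdiff : DifferentiableAt ℝ (T.cyclePoint κ k) θ :=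
    (ContDiffAt.comp (f := fun θ => (κ, θ)) θ (T.contDiffAt_cyclePoint k hκ.norm_lt θ)
      (contDiff_const.prodMk contDiff_id).contDiffAt).differentiableAt (by simp)
  have hunique : UniqueDiffWithinAt ℝ (Icc (0 : Fin m → ℝ) 1) θ := by
    rw [← pi_univ_Icc] at hθ ⊢
    exact UniqueDiffOn.univ_pi (fun _ => uniqueDiffOn_Icc zero_lt_one) θ hθ
  rw [fderivWithin_congr (fun θ' hθ' => T.cycleCube_clampCube κ k hθ')
    (T.cycleCube_clampCube κ k hθ), fderivWithin_eq_fderiv hunique hdiff,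
    T.cycleCube_clampCube κ k hθ]
  have hres := hω.fderiv_mul_apply (hκ.cyclePoint_mem_fiber k θ)
    (fun j => fderiv_pencilFun_eq_zero hdiff.hasFDerivAt (hκ.cyclePoint_mem_fiber k) _)
    (hasFDerivAt_torusPoint_apply_succ hdiff.hasFDerivAt)
  have hN := T.fderiv_pencilFun_mul (hκ.norm_branch_lt k θ) (hκ.branch_ne_zero k θ)
    (hκ.mul_scaledCoeff_mul_character_eq k θ)
  rw [← cyclePoint] at hN
  refine mul_left_cancel₀ (left_ne_zero_of_mul_eq_one hres) (hres.trans ?_)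
  rw [mul_left_comm, hN, inv_mul_cancel₀ T.natCast_N_ne_zero]

theorem IsRootAt.integralCube_cycleCube {ω : RelativeForm m} {κ t : ℂ} (hκ : T.IsRootAt κ t)
    (hω : IsResidueAt f ω t) (k : ℤ) :
    integralCube (ω.at t) (T.cycleCube κ k) = (T.N : ℂ)⁻¹ *
      ∫ θ in Icc (0 : Fin m → ℝ) 1, lagrangeLogDeriv (T.kernel θ) (T.branch κ k θ) := by
  rw [← MeasureTheory.integral_const_mul]
  exact MeasureTheory.setIntegral_congr_fun measurableSet_Icc fun _ hθ =>
    hκ.residue_pullback hω k hθ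

end DominantTerm

end Residue

section Summation

open Metric Set Filter Topology MeasureTheory

theorem sum_pow_pow_of_isPrimitiveRoot {R : Type*} [CommRing R] [IsDomain R] {ζ : R} {N : ℕ}
    (hζ : IsPrimitiveRoot ζ N) (n : ℕ) :
    ∑ k ∈ Finset.range N, (ζ ^ k) ^ n = if N ∣ n then (N : R) else 0 := by
  simp only [pow_right_comm ζ _ n]
  split_ifs with hdvd
  · simp [(hζ.pow_eq_one_iff_dvd n).2 hdvd]
  · refine eq_zero_of_ne_zero_of_mul_left_eq_zero
      (sub_ne_zero.2 fun h => hdvd ((hζ.pow_eq_one_iff_dvd n).1 h)) ?_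
    rw [mul_geom_sum, pow_right_comm, hζ.pow_eq_one, one_pow, sub_self]

theorem hasSum_multisection {R : Type*} [CommRing R] [IsDomain R] [TopologicalSpace R]
    [ContinuousAdd R] {ζ : R} {N : ℕ} (hN : N ≠ 0) (hζ : IsPrimitiveRoot ζ N) {a : ℕ → R}
    {s : ℕ → R} (h : ∀ k ∈ Finset.range N, HasSum (fun n => (ζ ^ k) ^ n * a n) (s k)) :
    HasSum (fun i => N * a (N * i)) (∑ k ∈ Finset.range N, s k) := by
  have hsum := hasSum_sum h
  simp only [← Finset.sum_mul, sum_pow_pow_of_isPrimitiveRoot hζ] at hsum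
  rw [← (mul_right_injective₀ hN).hasSum_iff] at hsum
  · simpa [Function.comp_def] using hsum
  · intro n hn
    rw [if_neg fun ⟨i, hi⟩ => hn ⟨i, hi.symm⟩, zero_mul]

namespace DominantTerm

variable {m : ℕ} {f : LaurentPoly ℂ (m + 1)} (T : DominantTerm f)

theorem branch_eq_mul (κ : ℂ) (k : ℕ) (θ : Fin m → ℝ) :
    T.branch κ k θ = Complex.exp (2 * Real.pi * Complex.I / T.N) ^ k * T.branch κ 0 θ := by
  rw [branch, branch, ← Complex.exp_nat_mul, mul_left_comm, ← Complex.exp_add]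
  congr 2
  push_cast
  ring

namespace IsRootAt

variable {T} {κ t : ℂ} (hκ : T.IsRootAt κ t)
include hκ

theorem circleIntegral_branch_pow {R : ℝ} (hR₀ : 0 < R) (hR : R < 1 / 8) (θ : Fin m → ℝ) (i : ℕ) :
    ∮ z in C(0, R), (T.branch κ 0 θ / z) ^ (T.N * i) * (z⁻¹ * lagrangeLogDeriv (T.kernel θ) z) =
      2 * Real.pi * Complex.I * (t ^ i * partialConstTerm T.r (f ^ i) θ) := by
  rw [mul_left_comm, ← circleIntegral_eval_torusPoint (T.isLagrangeKernel θ) hR₀ hR,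
    ← circleIntegral.integral_const_mul]
  refine circleIntegral.integral_congr hR₀.le fun z hz => ?_
  rw [mem_sphere_zero_iff_norm] at hz
  have hz₁ : ‖z‖ < 1 / 8 := by rwa [hz]
  have hz₀ : z ≠ 0 := norm_pos_iff.1 (by rwa [hz])
  change _ = t ^ i * (eval (f ^ i) (T.solutionPoint z θ) * _)
  rw [eval_pow (T.solutionPoint_ne_zero hz₁ hz₀ θ), T.eval_solutionPoint hz₁ hz₀,
    ← mul_assoc (t ^ i), ← mul_pow, ← mul_div_assoc,
    hκ.mul_scaledCoeff_mul_character_eq 0 θ, ← div_pow, ← pow_mul]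

theorem hasSum_partialConstTerm (θ : Fin m → ℝ) :
    HasSum (fun i : ℕ => t ^ i * partialConstTerm T.r (f ^ i) θ)
      ((T.N : ℂ)⁻¹ * ∑ k ∈ Finset.range T.N, lagrangeLogDeriv (T.kernel θ) (T.branch κ k θ)) := by
  obtain ⟨R, hκR, hR⟩ := exists_between hκ.norm_lt
  have hR₀ : 0 < R := (norm_nonneg κ).trans_lt hκR
  have hcauchy (k : ℕ) :
      HasSum (fun n : ℕ => (Complex.exp (2 * Real.pi * Complex.I / T.N) ^ k) ^ n *
          ∮ z in C(0, R), (T.branch κ 0 θ / z) ^ n * (z⁻¹ * lagrangeLogDeriv (T.kernel θ) z))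
        (2 * Real.pi * Complex.I * lagrangeLogDeriv (T.kernel θ) (T.branch κ k θ)) := by
    have h := hasSum_circleIntegral_div_pow (w := T.branch κ k θ)
      ((T.isLagrangeKernel θ).differentiableOn_lagrangeLogDeriv.mono (closedBall_subset_ball hR))
      (by rwa [T.norm_branch])
    simpa only [T.branch_eq_mul κ k θ, mul_div_assoc, mul_pow, mul_assoc,
      circleIntegral.integral_const_mul] using h
  have hsum := hasSum_multisection T.N_ne_zero (Complex.isPrimitiveRoot_exp T.N T.N_ne_zero)
    fun k _ => hcauchy k
  simp only [hκ.circleIntegral_branch_pow hR₀ hR, ← Finset.mul_sum] at hsum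
  have hN := T.natCast_N_ne_zero
  convert! hsum.mul_left (2 * Real.pi * Complex.I * T.N)⁻¹ using 1
  · ext i
    field_simp
  · field_simp

theorem norm_partialConstTerm_le {R : ℝ} (hR₀ : 0 < R) (hR : R < 1 / 8) (θ : Fin m → ℝ) (i : ℕ) :
    ‖t ^ i * partialConstTerm T.r (f ^ i) θ‖ ≤ 2 * ((‖κ‖ / R) ^ T.N) ^ i := by
  have hcauchy : t ^ i * partialConstTerm T.r (f ^ i) θ = (2 * (Real.pi : ℂ) * Complex.I)⁻¹ •
      ∮ z in C(0, R), (T.branch κ 0 θ / z) ^ (T.N * i) *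
        (z⁻¹ * lagrangeLogDeriv (T.kernel θ) z) := by
    rw [hκ.circleIntegral_branch_pow hR₀ hR, smul_eq_mul,
      inv_mul_cancel_left₀ Complex.two_pi_I_ne_zero]
  have hbound : ∀ z ∈ sphere (0 : ℂ) R, ‖(T.branch κ 0 θ / z) ^ (T.N * i) *
      (z⁻¹ * lagrangeLogDeriv (T.kernel θ) z)‖ ≤ (‖κ‖ / R) ^ (T.N * i) * (R⁻¹ * 2) := by
    intro z hz
    rw [mem_sphere_zero_iff_norm] at hz
    rw [norm_mul, norm_pow, norm_div, T.norm_branch, hz, norm_mul, norm_inv, hz]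
    gcongr
    exact (T.isLagrangeKernel θ).norm_lagrangeLogDeriv_le (by rwa [hz])
  rw [hcauchy, ← pow_mul]
  refine (circleIntegral.norm_two_pi_i_inv_smul_integral_le_of_norm_le_const hR₀.le
    hbound).trans_eq ?_
  field_simp

theorem continuous_lagrangeLogDeriv_branch (k : ℤ) :
    Continuous fun θ : Fin m → ℝ => lagrangeLogDeriv (T.kernel θ) (T.branch κ k θ) := by
  have hbranch : Continuous fun θ : Fin m → ℝ => T.branch κ k θ :=
    (T.contDiff_branch k).continuous.comp (Continuous.prodMk_right κ)
  exact continuous_iff_continuousAt.2 fun θ =>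
    ContinuousAt.comp (f := fun θ => (θ, T.branch κ k θ))
      (continuousAt_lagrangeLogDeriv T.contDiffOn_kernel T.isLagrangeKernel θ
        (hκ.norm_branch_lt k θ)) (continuous_id.prodMk hbranch).continuousAt

theorem sum_integralCube_cycleCube {ω : RelativeForm m} (hω : IsResidueAt f ω t) :
    ∑ k ∈ Finset.range T.N, integralCube (ω.at t) (T.cycleCube κ k) =
      ∫ θ in Icc (0 : Fin m → ℝ) 1, (T.N : ℂ)⁻¹ *
        ∑ k ∈ Finset.range T.N, lagrangeLogDeriv (T.kernel θ) (T.branch κ k θ) := by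
  rw [integral_const_mul, integral_finsetSum _ fun (k : ℕ) _ =>
    (hκ.continuous_lagrangeLogDeriv_branch k).integrableOn_Icc, Finset.mul_sum]
  exact Finset.sum_congr rfl fun k _ => hκ.integralCube_cycleCube hω k

theorem hasSum_constTerm {ω : RelativeForm m} (hω : IsResidueAt f ω t) :
    HasSum (fun i : ℕ => constTerm f i * t ^ i)
      (∑ k ∈ Finset.range T.N, integralCube (ω.at t) (T.cycleCube κ k)) := by
  obtain ⟨R, hκR, hR⟩ := exists_between hκ.norm_lt
  have hR₀ : 0 < R := (norm_nonneg κ).trans_lt hκR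
  have hterm (i : ℕ) : constTerm f i * t ^ i =
      ∫ θ in Icc (0 : Fin m → ℝ) 1, t ^ i * partialConstTerm T.r (f ^ i) θ := by
    rw [integral_const_mul, setIntegral_partialConstTerm, constTerm, mul_comm]
  have hsum : Summable fun i : ℕ => 2 * ((‖κ‖ / R) ^ T.N) ^ i :=
    (summable_geometric_of_lt_one (by positivity)
      (pow_lt_one₀ (by positivity) ((div_lt_one hR₀).2 hκR) T.N_ne_zero)).mul_left _
  simp only [hterm, hκ.sum_integralCube_cycleCube hω]
  exact hasSum_integral_of_dominated_convergence (fun i _ => 2 * ((‖κ‖ / R) ^ T.N) ^ i)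
    (fun i => (continuous_const.mul (continuous_partialConstTerm _ _)).aestronglyMeasurable)
    (fun i => .of_forall fun θ => hκ.norm_partialConstTerm_le hR₀ hR θ i)
    (.of_forall fun _ => hsum) continuous_const.integrableOn_Icc
    (.of_forall hκ.hasSum_partialConstTerm)

end IsRootAt

end DominantTerm

end Summation

section TaylorSeries

open Filter Topology

/-- `P` is the Taylor series of the analytic function `g` at `0`. -/
def IsTaylorSeries (P : PowerSeries ℂ) (g : ℂ → ℂ) : Prop :=
  AnalyticAt ℂ g 0 ∧ ∀ n, PowerSeries.coeff n P * n.factorial = iteratedDeriv n g 0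

namespace IsTaylorSeries

theorem of_hasSum {c : ℕ → ℂ} {g : ℂ → ℂ}
    (h : ∀ᶠ t in 𝓝 0, HasSum (fun n => c n * t ^ n) (g t)) :
    IsTaylorSeries (PowerSeries.mk c) g := by
  have hg : HasFPowerSeriesAt g (FormalMultilinearSeries.ofScalars ℂ c) 0 :=
    hasFPowerSeriesAt_iff.2 <| h.mono fun t ht => by
      simpa only [FormalMultilinearSeries.coeff_ofScalars, smul_eq_mul, mul_comm, zero_add] using ht
  refine ⟨hg.analyticAt, fun n => ?_⟩
  have hcoeff : c n = iteratedDeriv n g 0 / n.factorial :=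
    congrFun (FormalMultilinearSeries.ofScalars_series_injective ℂ ℂ
      (hg.eq_formalMultilinearSeries hg.analyticAt.hasFPowerSeriesAt)) n
  rw [PowerSeries.coeff_mk, hcoeff, div_mul_cancel₀ _ (Nat.cast_ne_zero.2 n.factorial_ne_zero)]

theorem coe_polynomial (p : Polynomial ℂ) :
    IsTaylorSeries (p : PowerSeries ℂ) fun t => p.eval t := by
  rw [Polynomial.coe_def]
  refine of_hasSum (.of_forall fun t => ?_)
  rw [p.eval_eq_sum]
  exact hasSum_sum_of_ne_finset_zero fun n hn => by
    rw [Polynomial.notMem_support_iff.1 hn, zero_mul]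

variable {P Q : PowerSeries ℂ} {g h : ℂ → ℂ} (hg : IsTaylorSeries P g)
include hg

theorem add (hh : IsTaylorSeries Q h) : IsTaylorSeries (P + Q) fun t => g t + h t := by
  refine ⟨hg.1.add hh.1, fun n => ?_⟩
  rw [iteratedDeriv_fun_add hg.1.contDiffAt hh.1.contDiffAt, map_add, add_mul, hg.2, hh.2]

theorem mul (hh : IsTaylorSeries Q h) : IsTaylorSeries (P * Q) fun t => g t * h t := by
  refine ⟨hg.1.mul hh.1, fun n => ?_⟩
  rw [iteratedDeriv_fun_mul hg.1.contDiffAt hh.1.contDiffAt, PowerSeries.coeff_mul,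
    Finset.Nat.sum_antidiagonal_eq_sum_range_succ
      (fun i j => PowerSeries.coeff i P * PowerSeries.coeff j Q), Finset.sum_mul]
  refine Finset.sum_congr rfl fun i hi => ?_
  rw [← hg.2, ← hh.2, ← Nat.choose_mul_factorial_mul_factorial (Finset.mem_range_succ_iff.1 hi)]
  push_cast
  ring

theorem derivative : IsTaylorSeries (PowerSeries.derivative ℂ P) (deriv g) := by
  refine ⟨hg.1.deriv, fun n => ?_⟩
  rw [← iteratedDeriv_succ', ← hg.2, PowerSeries.coeff_derivative, Nat.factorial_succ]
  push_cast
  ring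

theorem iterate_derivative (k : ℕ) :
    IsTaylorSeries ((PowerSeries.derivative ℂ)^[k] P) (iteratedDeriv k g) := by
  induction k with
  | zero => simpa using hg
  | succ k ih =>
    rw [Function.iterate_succ_apply', iteratedDeriv_succ]
    exact ih.derivative

theorem applySeries (L : DiffOp) : IsTaylorSeries (L.applySeries P) (L.applyFun g) := by
  unfold DiffOp.applySeries DiffOp.applyFun Polynomial.sum
  induction L.support using Finset.induction_on with
  | empty => exact ⟨by simpa using analyticAt_const, fun n => by simp⟩
  | insert k s hk ih =>
    simp only [Finset.sum_insert hk]
    exact ((coe_polynomial _).mul (hg.iterate_derivative k)).add ih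

theorem eq_zero (hzero : ∀ᶠ t in 𝓝[≠] 0, g t = 0) : P = 0 := by
  have hg₀ : g =ᶠ[𝓝 0] fun _ => 0 :=
    hg.1.frequently_zero_iff_eventually_zero.1 hzero.frequently
  ext n
  simpa [hg₀.iteratedDeriv_eq, n.factorial_ne_zero] using hg.2 n

end IsTaylorSeries

theorem DiffOp.applyFun_congr (L : DiffOp) {g h : ℂ → ℂ} {t : ℂ} (hgh : g =ᶠ[𝓝 t] h) :
    L.applyFun g t = L.applyFun h t := by
  simp only [applyFun, hgh.iteratedDeriv_eq]

end TaylorSeries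

section PicardFuchs

open Filter Topology

/-- Near `t₀` the form `ω_t` is the residue form, and its periods over some family of cycles are the
values of the convergent series `Φ_f(t)`. -/
def IsPeriodNear {m : ℕ} (f : LaurentPoly ℂ (m + 1)) (ω : RelativeForm m) (t₀ : ℂ) : Prop :=
  ∃ D : Set ℂ, IsOpen D ∧ t₀ ∈ D ∧ (∀ t ∈ D, t ≠ 0 ∧ IsResidueAt f ω t) ∧
    ∃ Δ : CycleFamily f D, ∀ t ∈ D, HasSum (fun i : ℕ => constTerm f i * t ^ i) (period ω Δ t)

variable {m : ℕ} {f : LaurentPoly ℂ (m + 1)} {ω : RelativeForm m}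

theorem IsPicardFuchs.applySeries_constTermSeries {L : DiffOp} (hL : IsPicardFuchs f ω L)
    (h : ∀ᶠ t in 𝓝[≠] 0, IsPeriodNear f ω t) : L.applySeries (constTermSeries f) = 0 := by
  let Φ (t : ℂ) : ℂ := ∑' i : ℕ, constTerm f i * t ^ i
  have hΦ : ∀ᶠ t in 𝓝 (0 : ℂ), HasSum (fun i : ℕ => constTerm f i * t ^ i) (Φ t) := by
    filter_upwards [eventually_nhdsWithin_iff.1 h] with t ht
    refine Summable.hasSum ?_
    obtain rfl | ht₀ := eq_or_ne t 0
    · exact summable_of_ne_finset_zero (s := {0}) fun i hi => by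
        rw [zero_pow (Finset.notMem_singleton.1 hi), mul_zero]
    · obtain ⟨D, -, htD, -, Δ, hΔ⟩ := ht ht₀
      exact (hΔ t htD).summable
  refine ((IsTaylorSeries.of_hasSum hΦ).applySeries L).eq_zero ?_
  filter_upwards [h] with t ⟨D, hD, htD, hres, Δ, hΔ⟩
  have hperiod : Φ =ᶠ[𝓝 t] period ω Δ := by
    filter_upwards [hD.mem_nhds htD] with s hs using (hΔ s hs).tsum_eq
  rw [L.applyFun_congr hperiod, hL.2 D hD hres Δ t htD]

theorem exists_analyticAt_pow_eq {N : ℕ} (hN : N ≠ 0) {a : ℂ} (ha : a ≠ 0) :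
    ∃ ρ : ℂ → ℂ, AnalyticAt ℂ ρ a ∧ ∀ᶠ z in 𝓝 a, ρ z ^ N = z := by
  have hdiv : AnalyticAt ℂ (fun z => z / a) a := analyticAt_id.div_const
  have hslit : a / a ∈ Complex.slitPlane := by simp [ha]
  refine ⟨fun z => Complex.exp ((Complex.log (z / a) + Complex.log a) / N),
    (((hdiv.clog hslit).add analyticAt_const).div_const).cexp, ?_⟩
  filter_upwards [hdiv.continuousAt.eventually (Complex.isOpen_slitPlane.mem_nhds hslit)] with z hz
  rw [← Complex.exp_nat_mul, mul_div_cancel₀ _ (Nat.cast_ne_zero.2 hN), Complex.exp_add,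
    Complex.exp_log (Complex.slitPlane_ne_zero hz), Complex.exp_log ha, div_mul_cancel₀ _ ha]

namespace DominantTerm

variable (T : DominantTerm f)

theorem isRootAt_of_pow_eq {κ t : ℂ} (ht : t ≠ 0) (hlt : ‖t * T.scaledCoeff T.v‖ < (1 / 8) ^ T.N)
    (hκ : κ ^ T.N = t * T.scaledCoeff T.v) : T.IsRootAt κ t where
  norm_lt := lt_of_pow_lt_pow_left₀ T.N (by norm_num) (by rwa [← norm_pow, hκ])
  ne_zero := ne_zero_pow T.N_ne_zero (hκ ▸ mul_ne_zero ht T.scaledCoeff_v_ne_zero)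
  pow_eq := hκ

theorem isPeriodNear {t₀ : ℂ} (ht₀ : t₀ ≠ 0) (hlt : ‖t₀ * T.scaledCoeff T.v‖ < (1 / 8) ^ T.N)
    (hω : ∀ᶠ t in 𝓝 t₀, IsResidueAt f ω t) : IsPeriodNear f ω t₀ := by
  let c := T.scaledCoeff T.v
  obtain ⟨ρ, hρ, hpow⟩ :=
    exists_analyticAt_pow_eq T.N_ne_zero (mul_ne_zero ht₀ T.scaledCoeff_v_ne_zero)
  have hmul : ContinuousAt (fun t => t * c) t₀ := by fun_prop
  have hlocal : ∀ᶠ t in 𝓝 t₀, AnalyticAt ℂ (fun t => ρ (t * c)) t ∧ T.IsRootAt (ρ (t * c)) t ∧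
      t ≠ 0 ∧ IsResidueAt f ω t := by
    filter_upwards [hmul.eventually hρ.eventually_analyticAt, hmul.eventually hpow,
      hmul.norm.eventually_lt_const hlt, eventually_ne_nhds ht₀, hω] with t hρt hpowt hltt ht hωt
    exact ⟨hρt.fun_comp (f := fun t => t * c) (analyticAt_id.mul analyticAt_const),
      T.isRootAt_of_pow_eq ht hltt hpowt, ht, hωt⟩
  obtain ⟨D, hD, hDopen, ht₀D⟩ := eventually_nhds_iff.1 hlocal
  have hsmooth : ContDiffOn ℝ (⊤ : ℕ∞) (fun t => ρ (t * c)) D := fun t ht =>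
    (hD t ht).1.restrictScalars.contDiffAt.contDiffWithinAt
  refine ⟨D, hDopen, ht₀D, fun t ht => (hD t ht).2.2,
    T.cycleFamily hsmooth fun t ht => (hD t ht).2.1, fun t ht => ?_⟩
  rw [T.period_cycleFamily]
  exact (hD t ht).2.1.hasSum_constTerm (hD t ht).2.2.2

include T in
theorem eventually_isPeriodNear (hω : ∀ᶠ t in 𝓝[≠] 0, IsResidueAt f ω t) :
    ∀ᶠ t in 𝓝[≠] 0, IsPeriodNear f ω t := by
  have hsmall : ∀ᶠ t in 𝓝 (0 : ℂ), ‖t * T.scaledCoeff T.v‖ < (1 / 8) ^ T.N := by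
    refine ContinuousAt.eventually_lt (by fun_prop) continuousAt_const ?_
    simp
  filter_upwards [eventually_eventually_nhdsWithin.2 hω, hsmall.filter_mono nhdsWithin_le_nhds,
    self_mem_nhdsWithin] with t hωt hlt ht
  rw [isOpen_compl_singleton.nhdsWithin_eq ht] at hωt
  exact T.isPeriodNear ht hlt hωt

end DominantTerm

end PicardFuchs

end LaurentPencil

end

theorem mainTheorem4_general {m : ℕ} {f : LaurentPencil.LaurentPoly ℂ (m + 1)}
    (hf : ∃ a ∈ f.coeff.support, a 0 < 0) :
    ∃ ω : LaurentPencil.RelativeForm m,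
      (∃ ε : ℝ, 0 < ε ∧
        (∀ t : ℂ, t ≠ 0 → ‖t‖ < ε → LaurentPencil.IsResidueAt f ω t) ∧
        ∀ t₀ : ℂ, t₀ ≠ 0 → ‖t₀‖ < ε →
          ∃ D : Set ℂ, IsOpen D ∧ t₀ ∈ D ∧
            ∃ Δ : LaurentPencil.CycleFamily f D, ∀ t ∈ D,
              HasSum (fun i : ℕ => LaurentPencil.constTerm f i * t ^ i)
                (LaurentPencil.period ω Δ t)) ∧
      ∀ L : LaurentPencil.DiffOp, LaurentPencil.IsPicardFuchs f ω L →
        L.applySeries (LaurentPencil.constTermSeries f) = 0 := by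
  obtain ⟨T⟩ := LaurentPencil.exists_dominantTerm hf
  obtain ⟨ω, hω⟩ := LaurentPencil.exists_residueForm f
  have hperiod := T.eventually_isPeriodNear hω
  obtain ⟨ε, hε, hball⟩ := Metric.nhdsWithin_basis_ball.eventually_iff.1 hperiod
  have hnear (t : ℂ) (ht : t ≠ 0) (htε : ‖t‖ < ε) : LaurentPencil.IsPeriodNear f ω t :=
    hball ⟨mem_ball_zero_iff.2 htε, ht⟩
  refine ⟨ω, ⟨ε, hε, fun t ht htε => ?_, fun t₀ ht₀ ht₀ε => ?_⟩,
    fun L hL => hL.applySeries_constTermSeries hperiod⟩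
  · obtain ⟨D, -, htD, hres, -⟩ := hnear t ht htε
    exact (hres t htD).2
  · obtain ⟨D, hD, ht₀D, -, hΔ⟩ := hnear t₀ ht₀ ht₀ε
    exact ⟨D, hD, ht₀D, hΔ⟩

theorem mainTheorem4 (m : ℕ) (f : LaurentPencil.LaurentPoly ℂ (m + 1))
    (hf : (0 : Fin (m + 1) → ℝ) ∈ interior (LaurentPencil.newtonPolytope f)) :
    ∃ ω : LaurentPencil.RelativeForm m,
      (∃ ε : ℝ, 0 < ε ∧
        (∀ t : ℂ, t ≠ 0 → ‖t‖ < ε → LaurentPencil.IsResidueAt f ω t) ∧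
        ∀ t₀ : ℂ, t₀ ≠ 0 → ‖t₀‖ < ε →
          ∃ D : Set ℂ, IsOpen D ∧ t₀ ∈ D ∧
            ∃ Δ : LaurentPencil.CycleFamily f D, ∀ t ∈ D,
              HasSum (fun i : ℕ => LaurentPencil.constTerm f i * t ^ i)
                (LaurentPencil.period ω Δ t)) ∧
      ∀ L : LaurentPencil.DiffOp, LaurentPencil.IsPicardFuchs f ω L →
        L.applySeries (LaurentPencil.constTermSeries f) = 0 :=
  mainTheorem4_general (LaurentPencil.exists_neg_exponent hf 0)
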